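/- **Setting.** Let $K:\mathbb R\to\mathbb R$ be smooth with $K=1$ on $[0,1]$ and $K=0$ on $[4,\infty)$, let $A,B\in\mathbb R$, $0<\Lambda_R\le\Lambda_0$, $|B|\le\Lambda_R^2$, $|A|\le\Lambda_R^3$, and put $\Delta_\Lambda(k)=K(k^2/\Lambda^2)/(k^2+B)$ for $k\in\mathbb R^4$. For $n\ge1$ let $L_n(k_1,\dots,k_n,\Lambda)$ ($k_i\in\mathbb R^4$, $\sum_i k_i=0$, $\Lambda\in[\Lambda_R,\Lambda_0]$) be the vertex functions of an effective potential $L(\phi,\Lambda)=\sum_n\frac1{n!}\int \frac{d^4k_1\cdots d^4k_n}{(2\pi)^{4n-4}}\,L_n\,\delta^4(\sum_i k_i)\,\phi(k_1)\cdots\phi(k_n)$ in generalized perturbation theory, i.e. formal power series $$L_n=\sum_{r_1,\dots,r_5\ge0}(\rho_4^R)^{r_1}(\rho_5^R)^{r_2}(\rho_6^0)^{r_3}(\rho_7^0)^{r_4}(\rho_8^0)^{r_5}\,L_n^{(r_1,\dots,r_5)} .$$ The coefficients are real, smooth in the momenta with all momentum derivatives continuous in $(k,\Lambda)$, $O(4)$-invariant,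 vanish for $r_1=\dots=r_5=0$, and at each order $r=(r_1,\dots,r_5)$ there are no vertex functions with more than $N(r)$ legs, for a given function $N$ (for instance $N(r)=3(r_1+\dots+r_5)+2$). They solve Polchinski's equation $$\frac{d}{d\Lambda}L_n(k,\Lambda)=-\frac12\sum_{S\subseteq\{1,\dots,n\}}\Delta_\Lambda'(K_S)\,\bar L_{|S|+1}(k_S,-K_S)\,\bar L_{n-|S|+1}(k_{S^c},K_S)-\frac12\int\frac{d^4q}{(2\pi)^4}\,\bar L_{n+2}(k,q,-q)\,\Delta_\Lambda'(q)-\frac12A\,\bar L_{n+1}(k,0)\,\Delta_\Lambda'(0),$$ where $\Delta'_\Lambda=\frac{d}{d\Lambda}\Delta_\Lambda$, $K_S=\sum_{i\in S}k_i$, and $\bar L_n$ is the average of $L_n$ over all permutations of its momenta (so $\bar L_n=L_n$ for symmetric kernels; symmetry is not assumed). Put $\partial^\mu_{i,j}=\partial/\partial k_i^\mu-\partial/\partial k_j^\mu$; $\partial^p$ stands for any product of $p$ such derivatives. Put $r_{NR}=r_3+r_4+r_5$, $$A_n^{(r_1,\dots,r_5)}=\Lambda^{\,n-4+r_1-r_{NR}}L_n^{(r_1,\dots,r_5)},\qquad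 \|f(\Lambda)\|=\max\{|f(k_1,\dots,k_n,\Lambda)|:\ \textstyle\sum_ik_i=0,\ k_i^2\le4\Lambda^2\ \text{for all } i\}.$$ **Renormalization conditions** at $\Lambda_R$: $L_1(0)=0$, $L_2(0,0)=0$, $\partial^\mu_{1,2}\partial^\nu_{1,2}L_2|_{k=0}=0$, $L_3(0,0,0)=\rho_4^R$, $L_4(0,0,0,0)=\rho_5^R$. **Initial conditions** at $\Lambda_0$: $\partial^\mu_{i,3}\partial^\nu_{i,3}L_3|_{k=0}=\rho_6^0\,\delta^{\mu\nu}$ ($i=1,2$), $\partial^\mu_{i,3}\partial^\nu_{j,3}L_3|_{k=0}=\rho_7^0\,\delta^{\mu\nu}$ ($\{i,j\}=\{1,2\}$), $L_5(0,\dots,0)=\rho_8^0$. **Theorem (Boundedness II).** Suppose in addition that for all $n\ge1$, $p\ge0$ with $n+p\ge6$ and all $(r_1,\dots,r_5)$ $$\|\partial^pA_n^{(r_1,\dots,r_5)}(\Lambda_0)\|\le\Lambda_0^{-p}\Big(\frac{\Lambda_0}{\Lambda_R}\Big)^{r_1}\mathrm{Pln}\Big(\frac{\Lambda_0}{\Lambda_R}\Big).$$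 Then for all $n\ge1$, $p\ge0$, $(r_1,\dots,r_5)$ and $\Lambda_R\le\Lambda\le\Lambda_0$ $$\|\partial^pA_n^{(r_1,\dots,r_5)}(\Lambda)\|\le\Lambda^{-p}\Big(\frac{\Lambda}{\Lambda_R}\Big)^{r_1}\Big(\frac{\Lambda_0}{\Lambda}\Big)^{r_{NR}}\Big(\delta_{r_{NR},0}\,\mathrm{Pln}\Big(\frac{\Lambda}{\Lambda_R}\Big)+\frac{\Lambda}{\Lambda_0}\,\mathrm{Pln}\Big(\frac{\Lambda_0}{\Lambda_R}\Big)\Big).$$ Here each $\mathrm{Pln}(z)$ is a polynomial in $\ln z$ with nonnegative coefficients which may differ at each occurrence and depends on $n,p,(r_1,\dots,r_5)$. The polynomials in the conclusion depend only on these, on $K$, $N$, and the polynomials in the hypothesis, and not on $\Lambda,\Lambda_R,\Lambda_0,A,B$ or the vertex functions. -/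

import Mathlib

open Set Filter Topology MeasureTheory
open scoped ContDiff

noncomputable section

/-- Euclidean momentum space in four dimensions. -/
abbrev Momentum : Type := EuclideanSpace ℝ (Fin 4)

/-- Configurations `(k₁, …, kₙ)` of momenta with `k₁ + ⋯ + kₙ = 0`: the domain of the `n`-point
vertex function, which stands in front of the conservation factor `δ⁴(∑ kᵢ)`. -/
def MomConf (n : ℕ) : Submodule ℝ (Fin n → Momentum) where
  carrier := {k | ∑ i, k i = 0}
  add_mem' := by
    intro a b ha hb
    simp only [mem_ofPred_eq, Pi.add_apply, Finset.sum_add_distrib] at *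
    rw [ha, hb, add_zero]
  zero_mem' := by simp
  smul_mem' := by
    intro c a ha
    simp only [mem_ofPred_eq, Pi.smul_apply] at *
    rw [← Finset.smul_sum, ha, smul_zero]

/-- The direction of the derivative `∂^μ_{i,j} = ∂/∂k_i^μ - ∂/∂k_j^μ`, tangent to `∑ kᵢ = 0`. -/
def relDir {n : ℕ} (i j : Fin n) (μ : Fin 4) : MomConf n :=
  ⟨Pi.single i (EuclideanSpace.single μ 1) - Pi.single j (EuclideanSpace.single μ 1), by
    change ∑ l, _ = _
    simp [Finset.sum_sub_distrib, Finset.sum_pi_single']⟩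

/-- The configuration `(k_S, K)` with `k_S` the momenta in `S`, in increasing order of their labels,
and `K = -∑_{i ∈ S} kᵢ` in the last place. -/
def legs {n : ℕ} (S : Finset (Fin n)) (k : MomConf n) : MomConf (S.card + 1) :=
  ⟨Fin.snoc (α := fun _ => Momentum) (fun i => k.1 (S.orderEmbOfFin rfl i)) (-∑ i ∈ S, k.1 i), by
    change ∑ l, _ = _
    rw [Fin.sum_univ_castSucc]
    simp only [Fin.snoc_castSucc, Fin.snoc_last]
    have h : ∑ i, k.1 (S.orderEmbOfFin rfl i) = ∑ i ∈ S, k.1 i := by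
      rw [← Finset.sum_coe_sort S]
      exact Fintype.sum_equiv (S.orderIsoOfFin rfl).toEquiv _ _ (fun i => rfl)
    rw [h, add_neg_cancel]⟩

/-- The configuration `(k₁, …, kₙ, q, -q)`. -/
def loopLegs {n : ℕ} (k : MomConf n) (q : Momentum) : MomConf (n + 2) :=
  ⟨Fin.snoc (α := fun _ => Momentum) (Fin.snoc (α := fun _ => Momentum) k.1 q) (-q), by
    have hk : ∑ i, k.1 i = 0 := k.2
    change ∑ l, _ = _
    rw [Fin.sum_univ_castSucc, Fin.sum_univ_castSucc]
    simp only [Fin.snoc_castSucc, Fin.snoc_last]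
    rw [hk]; simp⟩

/-- The configuration `(k₁, …, kₙ, 0)`. -/
def zeroLeg {n : ℕ} (k : MomConf n) : MomConf (n + 1) :=
  ⟨Fin.snoc (α := fun _ => Momentum) k.1 0, by
    have hk : ∑ i, k.1 i = 0 := k.2
    change ∑ l, _ = _
    rw [Fin.sum_univ_castSucc]
    simp only [Fin.snoc_castSucc, Fin.snoc_last]
    rw [hk]; simp⟩

/-- The simultaneous action of an orthogonal transformation on all momenta. -/
def rotate {n : ℕ} (R : Momentum ≃ₗᵢ[ℝ] Momentum) (k : MomConf n) : MomConf n :=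
  ⟨fun i => R (k.1 i), by
    have hk : ∑ i, k.1 i = 0 := k.2
    change ∑ l, R (k.1 l) = _
    rw [← map_sum, hk, map_zero]⟩

/-- The configuration with the momenta permuted by `σ`. -/
def permute {n : ℕ} (σ : Equiv.Perm (Fin n)) (k : MomConf n) : MomConf n :=
  ⟨fun i => k.1 (σ i), by
    have hk : ∑ i, k.1 i = 0 := k.2
    change ∑ l, k.1 (σ l) = _
    rw [Equiv.sum_comp σ k.1, hk]⟩

/-- A smooth cutoff function, equal to `1` on `[0, 1]` and to `0` on `[4, ∞)`. -/
structure IsCutoff (K : ℝ → ℝ) : Prop where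
  smooth : ContDiff ℝ ∞ K
  eq_one : ∀ z, 0 ≤ z → z ≤ 1 → K z = 1
  eq_zero : ∀ z, 4 ≤ z → K z = 0

/-- The regularized propagator `Δ_Λ(k) = K(k²/Λ²) / (k² + B)`. -/
def propagator (K : ℝ → ℝ) (B Λ : ℝ) (k : Momentum) : ℝ :=
  K (‖k‖ ^ 2 / Λ ^ 2) / (‖k‖ ^ 2 + B)

/-- `d/dΛ Δ_Λ(k)`. -/
def propagatorDeriv (K : ℝ → ℝ) (B Λ : ℝ) (k : Momentum) : ℝ :=
  deriv (fun s => propagator K B s k) Λ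

/-- Formal power series in the five couplings: the indeterminates `X 0`, `X 1`, `X 2`, `X 3`, `X 4`
are `ρ₄ᴿ`, `ρ₅ᴿ`, `ρ₆⁰`, `ρ₇⁰`, `ρ₈⁰` in this order. -/
abbrev CouplingSeries : Type := MvPowerSeries (Fin 5) ℝ

/-- Running vertex functions `L n k Λ = Lₙ(k₁, …, kₙ, Λ)` (relevant for `n ≥ 1`) in generalized
perturbation theory, that is as formal power series in the couplings. -/
abbrev VertexFamily : Type := (n : ℕ) → MomConf n → ℝ → CouplingSeries

/-- The coefficient `L_n^{(r₁,…,r₅)}(k, Λ)`. -/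
def VertexFamily.order (L : VertexFamily) (r : Fin 5 →₀ ℕ) (n : ℕ) (Λ : ℝ) (k : MomConf n) : ℝ :=
  MvPowerSeries.coeff r (L n k Λ)

/-- The average over all permutations of the external momenta: only this part of the kernel `Lₙ`
contributes to the functional `∑ₙ (1/n!) ∫ Lₙ δ⁴(∑ kᵢ) φ(k₁) ⋯ φ(kₙ)`. A kernel that is symmetric
in its momenta is its own symmetrization. -/
def VertexFamily.symmetrize (L : VertexFamily) : VertexFamily :=
  fun n k Λ => (n.factorial : ℝ)⁻¹ • ∑ σ : Equiv.Perm (Fin n), L n (permute σ k) Λ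

/-- `∂^p f (k)` for `∂^p = ∂^{μ₁}_{i₁,j₁} ⋯ ∂^{μₚ}_{iₚ,jₚ}` and a smooth function `f`. -/
def relDeriv {n : ℕ} (p : ℕ) (i j : Fin p → Fin n) (μ : Fin p → Fin 4) (f : MomConf n → ℝ)
    (k : MomConf n) : ℝ :=
  iteratedFDeriv ℝ p f k (fun a => relDir (i a) (j a) (μ a))

/-- The right-hand side of Polchinski's equation for `d/dΛ Lₙ(k, Λ)`, as a formal power series in
the couplings, for kernels `L` that are symmetric in their momenta. The sum over subsets `S` of the external legs is the sum over `l = |S| + 1` and over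
the `n choose (l - 1)` distributions of the external momenta on the two vertices. -/
def polchinskiRHS (K : ℝ → ℝ) (A B : ℝ) (L : VertexFamily) (n : ℕ) (k : MomConf n) (Λ : ℝ) :
    CouplingSeries :=
  fun r =>
    -(1 / 2) * ∑ S : Finset (Fin n), propagatorDeriv K B Λ (∑ i ∈ S, k.1 i) *
        MvPowerSeries.coeff r
          (L (S.card + 1) (legs S k) Λ * L (Sᶜ.card + 1) (legs Sᶜ k) Λ)
      - (1 / 2) * ((2 * Real.pi) ^ 4)⁻¹ *
          ∫ q : Momentum, L.order r (n + 2) Λ (loopLegs k q) * propagatorDeriv K B Λ q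
      - (1 / 2) * A * L.order r (n + 1) Λ (zeroLeg k) * propagatorDeriv K B Λ 0

/-- `L` is a solution of Polchinski's equation on `[Λ_R, Λ₀]` in generalized perturbation theory
with smooth, `O(4)`-invariant vertex functions. The kernels are not required to be symmetric in
their momenta (for a symmetric `L₃` the couplings `ρ₆` and `ρ₇` would not be independent); the
functional on the right-hand side of the equation sees their symmetrizations. `L` vanishes to zeroth order in the couplings, and
to each order `r` it has no vertex functions with more than `N r` legs. -/
structure IsPerturbativeFlow (K : ℝ → ℝ) (A B Λ_R Λ₀ : ℝ) (N : (Fin 5 →₀ ℕ) → ℕ)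
    (L : VertexFamily) : Prop where
  smooth : ∀ n, 1 ≤ n → ∀ r, ∀ Λ ∈ Icc Λ_R Λ₀, ContDiff ℝ ∞ (L.order r n Λ)
  continuousOn : ∀ n, 1 ≤ n → ∀ r, ∀ p : ℕ,
    ContinuousOn (fun x : MomConf n × ℝ => iteratedFDeriv ℝ p (L.order r n x.2) x.1)
      (univ ×ˢ Icc Λ_R Λ₀)
  invariant : ∀ n, 1 ≤ n → ∀ R : Momentum ≃ₗᵢ[ℝ] Momentum, ∀ k : MomConf n,
    ∀ Λ ∈ Icc Λ_R Λ₀, L n (rotate R k) Λ = L n k Λ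
  zeroth : ∀ n, 1 ≤ n → ∀ k : MomConf n, ∀ Λ ∈ Icc Λ_R Λ₀, L.order 0 n Λ k = 0
  finite : ∀ r n, 1 ≤ n → N r < n → ∀ k : MomConf n, ∀ Λ ∈ Icc Λ_R Λ₀, L.order r n Λ k = 0
  flow : ∀ n, 1 ≤ n → ∀ k : MomConf n, ∀ r, ∀ Λ ∈ Icc Λ_R Λ₀,
    HasDerivWithinAt (fun s => L.order r n s k)
      (MvPowerSeries.coeff r (polchinskiRHS K A B L.symmetrize n k Λ)) (Icc Λ_R Λ₀) Λ

/-- The formal power series `∂^μ_{i,j} ∂^ν_{i',j'} Lₙ(k, Λ)` at `k = 0`. -/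
def VertexFamily.hessianAtZero (L : VertexFamily) (n : ℕ) (Λ : ℝ) (i j i' j' : Fin n)
    (μ ν : Fin 4) : CouplingSeries :=
  fun r => relDeriv 2 ![i, i'] ![j, j'] ![μ, ν] (L.order r n Λ) 0

/-- The renormalization conditions
`ρ₁(Λ_R) = ρ₂(Λ_R) = ρ₃(Λ_R) = 0`, `ρ₄(Λ_R) = ρ₄ᴿ`, `ρ₅(Λ_R) = ρ₅ᴿ`. -/
structure RenormalizationConditions (L : VertexFamily) (Λ_R : ℝ) : Prop where
  rho1 : L 1 0 Λ_R = 0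
  rho2 : L 2 0 Λ_R = 0
  rho3 : ∀ μ ν : Fin 4, L.hessianAtZero 2 Λ_R 0 1 0 1 μ ν = 0
  rho4 : L 3 0 Λ_R = MvPowerSeries.X 0
  rho5 : L 4 0 Λ_R = MvPowerSeries.X 1

/-- The initial conditions `ρ₆(Λ₀) = ρ₆⁰`, `ρ₇(Λ₀) = ρ₇⁰`, `ρ₈(Λ₀) = ρ₈⁰`, where
`ρ₆ δ^{μν} = ∂^μ_{i,3} ∂^ν_{i,3} L₃ |_{k=0}` for `i = 1, 2`,
`ρ₇ δ^{μν} = ∂^μ_{i,3} ∂^ν_{j,3} L₃ |_{k=0}` for `i ≠ j` in `{1, 2}`, `ρ₈ = L₅(0)`.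
(Legs are numbered from `0` here.) -/
structure BareConditions (L : VertexFamily) (Λ₀ : ℝ) : Prop where
  rho6 : ∀ i : Fin 3, i ≠ 2 → ∀ μ ν : Fin 4,
    L.hessianAtZero 3 Λ₀ i 2 i 2 μ ν = if μ = ν then MvPowerSeries.X 2 else 0
  rho7 : ∀ i j : Fin 3, i ≠ 2 → j ≠ 2 → i ≠ j → ∀ μ ν : Fin 4,
    L.hessianAtZero 3 Λ₀ i 2 j 2 μ ν = if μ = ν then MvPowerSeries.X 3 else 0
  rho8 : L 5 0 Λ₀ = MvPowerSeries.X 4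

/-- The order `r_NR = r₃ + r₄ + r₅` in the bare nonrenormalizable couplings. -/
def orderNR (r : Fin 5 →₀ ℕ) : ℕ := r 2 + r 3 + r 4

/-- The dimensionless coefficient
`A_n^{(r₁,…,r₅)}(k, Λ) = Λ^{n - 4 + r₁ - r_NR} L_n^{(r₁,…,r₅)}(k, Λ)`. -/
def VertexFamily.dimensionless (L : VertexFamily) (r : Fin 5 →₀ ℕ) (n : ℕ) (Λ : ℝ)
    (k : MomConf n) : ℝ :=
  Λ ^ ((n : ℤ) - 4 + (r 0 : ℤ) - (orderNR r : ℤ)) * L.order r n Λ k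

/-- `‖∂^p f‖ ≤ c` for every `∂^p` of order `p`, where `‖·‖` is the maximum over the momenta with
`kᵢ² ≤ 4 Λ²` for all `i`. -/
def RelDerivNormLE {n : ℕ} (Λ : ℝ) (p : ℕ) (f : MomConf n → ℝ) (c : ℝ) : Prop :=
  ∀ (i j : Fin p → Fin n) (μ : Fin p → Fin 4) (k : MomConf n),
    (∀ l, ‖k.1 l‖ ^ 2 ≤ 4 * Λ ^ 2) → |relDeriv p i j μ f k| ≤ c

/-- All coefficients of the polynomial are nonnegative. -/
def NonnegCoeffs (P : Polynomial ℝ) : Prop := ∀ m, 0 ≤ P.coeff m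

end

/-! The proof is power counting by induction along the flow. Stripped of its normalization, the
claim says that the `p`-th derivatives of the `n`-point function at order `r` are at most
`Λ^(4-n-p)` times the weight `Λ_R^(-r₁) Λ₀^(r_NR)`, times the logarithmic factor `δ P(ln(Λ/Λ_R)) +
(Λ/Λ₀) Q(ln(Λ₀/Λ_R))`. Weights are multiplicative in `r`, and logarithmic factors are closed under
products up to new polynomials, so the class `PowerCounting` is stable under the operations in the
flow equation.

The induction is on the total order in the couplings, then downwards in `n` from the maximal number
of legs, then downwards in `p`. Tree terms are products of orders `r' + r'' = r`. Order zero
vanishes, so both factors have lower total order. The loop term has the same order and two more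
legs. The `A` term drops out because `d/dΛ Δ_Λ` vanishes at zero momentum. Hence the right-hand side
is already bounded, with one power of `Λ` less (`flow_bound`).

What remains is to integrate in the right direction. For `n + p ≥ 6` one integrates down from `Λ₀`,
where the bound is assumed. For `n + p = 5` one also integrates down; the value at `Λ₀` comes from
the bare conditions at zero momentum and a Taylor estimate with the next derivative. For `n + p ≤ 4`
one integrates up from `Λ_R` at zero momentum, where the renormalization conditions apply, and
reaches other momenta by Taylor. Parameters not fixed by a condition vanish by inversion symmetry or
because a one-point configuration is zero.

Two analytic points carry the rest. The flow equation is given pointwise in `k`, so momentum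
derivatives are handled through iterated finite differences. These commute with sums, the loop
integral and `d/dΛ`, and for smooth functions their bounds are equivalent to derivative bounds.
Moreover `|B| ≤ Λ_R²` lets the denominator `k² + B` vanish at the edge `k² = Λ²` of the support of
`d/dΛ Δ_Λ`; the flatness of `K'` there gives bounds uniform in `B`. -/

noncomputable section

/-! ### Iterated finite differences -/

section FiniteDifferences

variable {E : Type*} [NormedAddCommGroup E]

/-- The iterated finite difference of `f` with increments `v 0, …, v (p - 1)`. -/
def finDiff : (p : ℕ) → (Fin p → E) → (E → ℝ) → E → ℝ
  | 0, _, f => f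
  | p + 1, v, f => finDiff p (Fin.tail v) (fun x => f (x + v 0) - f x)

theorem finDiff_add (p : ℕ) (v : Fin p → E) (f g : E → ℝ) (x : E) :
    finDiff p v (fun y => f y + g y) x = finDiff p v f x + finDiff p v g x := by
  induction p generalizing f g with
  | zero => rfl
  | succ p ih =>
    simp only [finDiff]
    rw [← ih]
    congr 1
    funext y
    ring

theorem finDiff_const_mul (p : ℕ) (v : Fin p → E) (c : ℝ) (f : E → ℝ) (x : E) :
    finDiff p v (fun y => c * f y) x = c * finDiff p v f x := by
  induction p generalizing f with
  | zero => rfl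
  | succ p ih =>
    simp only [finDiff]
    rw [← ih]
    congr 1
    funext y
    ring

theorem finDiff_sub (p : ℕ) (v : Fin p → E) (f g : E → ℝ) (x : E) :
    finDiff p v (fun y => f y - g y) x = finDiff p v f x - finDiff p v g x := by
  have h := finDiff_add p v f (fun y => (-1) * g y) x
  rw [finDiff_const_mul] at h
  convert h using 1
  · congr 1
    funext y
    ring
  · ring

theorem finDiff_zero_fun (p : ℕ) (v : Fin p → E) (x : E) :
    finDiff p v (fun _ => (0 : ℝ)) x = 0 := by
  simpa using finDiff_const_mul p v 0 (fun _ => (0 : ℝ)) x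

theorem finDiff_sum {ι : Type*} (s : Finset ι) (p : ℕ) (v : Fin p → E) (f : ι → E → ℝ) (x : E) :
    finDiff p v (fun y => ∑ i ∈ s, f i y) x = ∑ i ∈ s, finDiff p v (f i) x := by
  classical
  induction s using Finset.induction_on with
  | empty => simpa using finDiff_zero_fun p v x
  | insert a s ha ih =>
    simp only [Finset.sum_insert ha]
    rw [finDiff_add, ih]

/-- A finite difference is a finite linear combination of values, so integrability at each point
suffices and no dominating function for derivatives is needed. -/
theorem finDiff_integral {X : Type*} [MeasurableSpace X] {ν : Measure X} (p : ℕ) (v : Fin p → E)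
    (f : X → E → ℝ) (hf : ∀ y, Integrable (fun q => f q y) ν) (x : E) :
    finDiff p v (fun y => ∫ q, f q y ∂ν) x = ∫ q, finDiff p v (f q) x ∂ν := by
  induction p generalizing f with
  | zero => rfl
  | succ p ih =>
    simp only [finDiff]
    rw [← ih (Fin.tail v) (fun q y => f q (y + v 0) - f q y) fun y => (hf _).sub (hf _)]
    congr 1
    funext y
    exact (integral_sub (hf _) (hf _)).symm

theorem hasDerivWithinAt_finDiff (p : ℕ) (v : Fin p → E) {f : ℝ → E → ℝ} {g : E → ℝ} {I : Set ℝ}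
    {s : ℝ} (h : ∀ y, HasDerivWithinAt (fun t => f t y) (g y) I s) (x : E) :
    HasDerivWithinAt (fun t => finDiff p v (f t) x) (finDiff p v g x) I s := by
  induction p generalizing f g with
  | zero => exact h x
  | succ p ih => exact ih _ fun y => (h _).sub (h _)

/-- The `p`-th finite differences of `f` inside the ball of radius `R` are those of a function whose
`p`-th derivative is bounded by `C`. -/
def FinDiffBound (p : ℕ) (R C : ℝ) (f : E → ℝ) : Prop :=
  ∀ (v : Fin p → E) (x : E), ‖x‖ + ∑ a, ‖v a‖ ≤ R → |finDiff p v f x| ≤ C * ∏ a, ‖v a‖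

theorem FinDiffBound.mono {p : ℕ} {R R' C C' : ℝ} {f : E → ℝ} (h : FinDiffBound p R C f)
    (hR : R' ≤ R) (hC : C ≤ C') : FinDiffBound p R' C' f := fun v x hx =>
  (h v x (hx.trans hR)).trans (mul_le_mul_of_nonneg_right hC (by positivity))

theorem FinDiffBound.add {p : ℕ} {R C C' : ℝ} {f g : E → ℝ} (hf : FinDiffBound p R C f)
    (hg : FinDiffBound p R C' g) : FinDiffBound p R (C + C') fun y => f y + g y := by
  intro v x hx
  rw [finDiff_add, add_mul]
  exact (abs_add_le _ _).trans (add_le_add (hf v x hx) (hg v x hx))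

theorem FinDiffBound.const_mul {p : ℕ} {R C : ℝ} {f : E → ℝ} (hf : FinDiffBound p R C f) (c : ℝ) :
    FinDiffBound p R (|c| * C) fun y => c * f y := by
  intro v x hx
  rw [finDiff_const_mul, abs_mul, mul_assoc]
  exact mul_le_mul_of_nonneg_left (hf v x hx) (abs_nonneg c)

theorem FinDiffBound.sum {ι : Type*} {s : Finset ι} {p : ℕ} {R : ℝ} {C : ι → ℝ} {f : ι → E → ℝ}
    (hf : ∀ i ∈ s, FinDiffBound p R (C i) (f i)) :
    FinDiffBound p R (∑ i ∈ s, C i) fun y => ∑ i ∈ s, f i y := by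
  intro v x hx
  rw [finDiff_sum, Finset.sum_mul]
  exact (Finset.abs_sum_le_sum_abs _ _).trans (Finset.sum_le_sum fun i hi => hf i hi v x hx)

theorem FinDiffBound.integral {X : Type*} [MeasurableSpace X] {ν : Measure X} {p : ℕ} {R : ℝ}
    {C : X → ℝ} {f : X → E → ℝ} (hf : ∀ q, FinDiffBound p R (C q) (f q)) (hC : Integrable C ν)
    (hi : ∀ y, Integrable (fun q => f q y) ν) :
    FinDiffBound p R (∫ q, C q ∂ν) fun y => ∫ q, f q y ∂ν := by
  intro v x hx
  rw [finDiff_integral _ _ _ hi, ← integral_mul_const]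
  exact MeasureTheory.norm_integral_le_of_norm_le (f := fun q => finDiff p v (f q) x)
    (hC.mul_const _) (Eventually.of_forall fun q => hf q v x hx)

variable [NormedSpace ℝ E]

/-- Induction on `p`: the first difference in direction `v 0` has `p`-th derivative close to
`T.curryLeft (v 0)`, by the mean value inequality along the segment. Taking `T = 0` turns derivative
bounds into difference bounds; taking `T` to be the derivative at `x` serves the converse. -/
theorem abs_finDiff_sub_le (p : ℕ) (v : Fin p → E) {f : E → ℝ} (hf : ContDiff ℝ ∞ f) {x : E}
    {T : E [×p]→L[ℝ] ℝ} {ε : ℝ}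
    (h : ∀ y, ‖y - x‖ ≤ ∑ a, ‖v a‖ → ‖iteratedFDeriv ℝ p f y - T‖ ≤ ε) :
    |finDiff p v f x - T v| ≤ ε * ∏ a, ‖v a‖ := by
  induction p generalizing f ε with
  | zero =>
    have h0 := h x (by simp)
    have h1 : (iteratedFDeriv ℝ 0 f x - T) v = f x - T v := by simp
    have h2 := (iteratedFDeriv ℝ 0 f x - T).le_opNorm v
    rw [h1] at h2
    simpa [finDiff] using h2.trans (mul_le_mul_of_nonneg_right h0 (by simp))
  | succ p ih =>
    have hT : T v = T.curryLeft (v 0) (Fin.tail v) := by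
      simp
    rw [hT, Fin.prod_univ_succ, ← mul_assoc]
    have hg : ContDiff ℝ ∞ fun y => f (y + v 0) - f y := by fun_prop
    refine ih (v := Fin.tail v) (T := T.curryLeft (v 0)) (f := fun y => f (y + v 0) - f y) hg
      (ε := ε * ‖v 0‖) fun y hy => ?_
    have hp : ContDiff ℝ (p : ℕ) f := hf.of_le (by exact_mod_cast le_top)
    have h1 : iteratedFDeriv ℝ p (fun y => f (y + v 0) - f y) y =
        iteratedFDeriv ℝ p f (y + v 0) - iteratedFDeriv ℝ p f y := by
      rw [← iteratedFDeriv_comp_add_right]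
      exact iteratedFDeriv_sub_apply (ContDiff.contDiffAt (by fun_prop)) hp.contDiffAt
    rw [h1]
    have hd : Differentiable ℝ (iteratedFDeriv ℝ p f) :=
      hf.differentiable_iteratedFDeriv (by exact_mod_cast ENat.natCast_lt_top p)
    have hseg : ∀ z ∈ segment ℝ y (y + v 0), ‖z - x‖ ≤ ∑ a, ‖v a‖ := by
      intro z hz
      rw [segment_eq_image'] at hz
      obtain ⟨t, ht, rfl⟩ := hz
      rw [Fin.sum_univ_succ]
      have hy' : ‖y - x‖ ≤ ∑ a : Fin p, ‖v a.succ‖ := hy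
      calc ‖y + t • (y + v 0 - y) - x‖ = ‖(y - x) + t • v 0‖ := by
            congr 1; rw [add_sub_cancel_left]; abel
        _ ≤ ‖y - x‖ + ‖t • v 0‖ := norm_add_le _ _
        _ ≤ _ := by
            have : ‖t • v 0‖ ≤ ‖v 0‖ := by
              rw [norm_smul, Real.norm_of_nonneg ht.1]
              exact mul_le_of_le_one_left (norm_nonneg _) ht.2
            linarith
    have := (convex_segment y (y + v 0)).norm_image_sub_le_of_norm_fderiv_le' (𝕜 := ℝ)
      (f := iteratedFDeriv ℝ p f) (φ := T.curryLeft) (C := ε) (fun z _ => hd z) (fun z hz => by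
        rw [fderiv_iteratedFDeriv]
        have h2 : (continuousMultilinearCurryLeftEquiv ℝ (fun _ : Fin (p + 1) => E) ℝ ∘
            iteratedFDeriv ℝ (p + 1) f) z - T.curryLeft =
            continuousMultilinearCurryLeftEquiv ℝ (fun _ : Fin (p + 1) => E) ℝ
              (iteratedFDeriv ℝ (p + 1) f z - T) := by
          ext; rfl
        rw [h2]
        refine (LinearIsometryEquiv.norm_map _ _).trans_le (h z (hseg z hz)))
      (left_mem_segment ℝ _ _) (right_mem_segment ℝ _ _)
    simpa using this

theorem FinDiffBound.of_norm_iteratedFDeriv_le {p : ℕ} {R C : ℝ} {f : E → ℝ}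
    (hf : ContDiff ℝ ∞ f) (h : ∀ y, ‖y‖ ≤ R → ‖iteratedFDeriv ℝ p f y‖ ≤ C) :
    FinDiffBound p R C f := by
  intro v x hx
  have := abs_finDiff_sub_le p v hf (x := x) (T := 0) (ε := C) fun y hy => by
    rw [sub_zero]
    refine h y ?_
    have := norm_add_le (y - x) x
    rw [sub_add_cancel] at this
    linarith
  simpa using this

/-- Differences with increments `t • v`, divided by `t ^ p`, approximate the derivative as `t`
becomes small. Strict inequality leaves room for the increments inside the ball; the closed ball
follows by continuity. -/
theorem FinDiffBound.norm_iteratedFDeriv_le_of_lt {p : ℕ} {R C : ℝ} {f : E → ℝ}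
    (hf : ContDiff ℝ ∞ f) (h : FinDiffBound p R C f) (hC : 0 ≤ C) {x : E} (hx : ‖x‖ < R) :
    ‖iteratedFDeriv ℝ p f x‖ ≤ C := by
  refine ContinuousMultilinearMap.opNorm_le_bound hC fun v => ?_
  refine le_of_forall_pos_le_add fun ε hε => ?_
  have hc : Continuous (iteratedFDeriv ℝ p f) :=
    hf.continuous_iteratedFDeriv (by exact_mod_cast le_top)
  set M := ∏ a, ‖v a‖ with hM
  have hM0 : 0 ≤ M := by positivity
  set S := ∑ a, ‖v a‖ with hS
  have hS0 : 0 ≤ S := by positivity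
  obtain ⟨δ, hδ, hδ'⟩ := Metric.continuousAt_iff.1 hc.continuousAt (ε / (M + 1)) (by positivity)
  -- The total increment `t * S` must stay below both `δ` and the distance to the sphere; `S + 1`
  -- avoids division by zero when all increments vanish.
  set t : ℝ := min (δ / 2) (R - ‖x‖) / (S + 1) with ht
  have hmin : 0 < min (δ / 2) (R - ‖x‖) := lt_min (by linarith) (by linarith)
  have ht0 : 0 < t := by positivity
  have htS : t * S ≤ min (δ / 2) (R - ‖x‖) := by
    rw [ht, div_mul_eq_mul_div, div_le_iff₀ (by linarith)]
    nlinarith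
  have hn : ∀ a, ‖(t • v) a‖ = t * ‖v a‖ := fun a => by
    rw [Pi.smul_apply, norm_smul, Real.norm_of_nonneg ht0.le]
  have hsum : ∑ a, ‖(t • v) a‖ = t * S := by simp only [hn, hS, Finset.mul_sum]
  have hprod : ∏ a, ‖(t • v) a‖ = t ^ p * M := by
    simp only [hn, Finset.prod_mul_distrib, Finset.prod_const, Finset.card_univ,
      Fintype.card_fin, hM]
  have h1 := h (t • v) x (by rw [hsum]; linarith [htS.trans (min_le_right _ _)])
  have h2 := abs_finDiff_sub_le p (t • v) hf (x := x) (T := iteratedFDeriv ℝ p f x)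
    (ε := ε / (M + 1)) fun y hy => by
      rw [hsum] at hy
      have : dist y x < δ := by
        rw [dist_eq_norm]
        linarith [htS.trans (min_le_left _ _)]
      have := hδ' this
      rw [dist_eq_norm] at this
      exact this.le
  rw [hprod] at h1 h2
  have h3 : iteratedFDeriv ℝ p f x (t • v) = t ^ p * iteratedFDeriv ℝ p f x v := by
    have := (iteratedFDeriv ℝ p f x).map_smul_univ (fun _ => t) v
    rw [Finset.prod_const, Finset.card_univ, Fintype.card_fin, smul_eq_mul] at this
    exact this
  rw [h3] at h2
  have htp : 0 < t ^ p := by positivity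
  have h4 : |t ^ p * iteratedFDeriv ℝ p f x v| ≤ C * (t ^ p * M) + ε / (M + 1) * (t ^ p * M) := by
    have := abs_sub_abs_le_abs_sub (t ^ p * iteratedFDeriv ℝ p f x v) (finDiff p (t • v) f x)
    rw [abs_sub_comm] at this
    linarith
  rw [abs_mul, abs_of_pos htp] at h4
  have h5 : |iteratedFDeriv ℝ p f x v| ≤ C * M + ε / (M + 1) * M := by
    refine le_of_mul_le_mul_left (h4.trans_eq ?_) htp
    ring
  have h6 : ε / (M + 1) * M ≤ ε := by
    rw [div_mul_eq_mul_div, div_le_iff₀ (by linarith)]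
    nlinarith
  rw [Real.norm_eq_abs]
  linarith

theorem FinDiffBound.norm_iteratedFDeriv_le {p : ℕ} {R C : ℝ} {f : E → ℝ} (hf : ContDiff ℝ ∞ f)
    (h : FinDiffBound p R C f) (hC : 0 ≤ C) (hR : 0 < R) {x : E} (hx : ‖x‖ ≤ R) :
    ‖iteratedFDeriv ℝ p f x‖ ≤ C := by
  have hc : Continuous fun x => ‖iteratedFDeriv ℝ p f x‖ :=
    (hf.continuous_iteratedFDeriv (by exact_mod_cast le_top)).norm
  have hx' : x ∈ closure (Metric.ball (0 : E) R) := by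
    rw [closure_ball _ hR.ne']
    simpa using hx
  refine closure_minimal (fun y hy => ?_) (isClosed_le hc continuous_const) hx'
  exact h.norm_iteratedFDeriv_le_of_lt hf hC (by simpa using hy)

/-- First-order Taylor estimate from the origin. It reduces derivatives with `n + p ≤ 5` to their
zero-momentum values and the next derivative. -/
theorem norm_iteratedFDeriv_le_add_mul {p : ℕ} {R C : ℝ} {f : E → ℝ} (hf : ContDiff ℝ ∞ f)
    (h : ∀ y, ‖y‖ ≤ R → ‖iteratedFDeriv ℝ (p + 1) f y‖ ≤ C) (hC : 0 ≤ C) {x : E} (hx : ‖x‖ ≤ R) :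
    ‖iteratedFDeriv ℝ p f x‖ ≤ ‖iteratedFDeriv ℝ p f 0‖ + C * R := by
  have hR : 0 ≤ R := (norm_nonneg x).trans hx
  have hd : Differentiable ℝ (iteratedFDeriv ℝ p f) :=
    hf.differentiable_iteratedFDeriv (by exact_mod_cast ENat.natCast_lt_top p)
  have := (convex_closedBall (0 : E) R).norm_image_sub_le_of_norm_fderiv_le (𝕜 := ℝ)
    (f := iteratedFDeriv ℝ p f) (C := C) (x := 0) (y := x) (fun z _ => hd z) (fun z hz => by
      rw [norm_fderiv_iteratedFDeriv]
      exact h z (by simpa using hz)) (by simpa using hR) (by simpa using hx)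
  rw [sub_zero] at this
  have h2 := norm_add_le (iteratedFDeriv ℝ p f x - iteratedFDeriv ℝ p f 0) (iteratedFDeriv ℝ p f 0)
  rw [sub_add_cancel] at h2
  nlinarith

end FiniteDifferences

/-! ### The regularized propagator -/

section Propagator

theorem deriv_eq_zero_of_const_on {f : ℝ → ℝ} (hf : Differentiable ℝ f) {s : Set ℝ} {c : ℝ}
    (h : ∀ x ∈ s, f x = c) {x : ℝ} (hs : UniqueDiffWithinAt ℝ s x) (hx : x ∈ s) :
    deriv f x = 0 := by
  have h1 : HasDerivWithinAt f (deriv f x) s x := (hf x).hasDerivAt.hasDerivWithinAt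
  have h2 : HasDerivWithinAt f 0 s x :=
    (hasDerivWithinAt_const x s c).congr (fun y hy => h y hy) (h x hx)
  exact hs.eq_deriv s h1 h2

/-- A smooth function supported in `[0, 3]`. -/
structure FlatBump (η : ℝ → ℝ) : Prop where
  smooth : ContDiff ℝ ∞ η
  left : ∀ w ≤ 0, η w = 0
  right : ∀ w, 3 ≤ w → η w = 0

theorem FlatBump.deriv {η : ℝ → ℝ} (h : FlatBump η) : FlatBump (deriv η) where
  smooth := (contDiff_infty_iff_deriv.1 h.smooth).2
  left w hw := deriv_eq_zero_of_const_on (h.smooth.differentiable (by simp)) (s := Iic 0) h.left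
    (uniqueDiffOn_Iic 0 w hw) hw
  right w hw := deriv_eq_zero_of_const_on (h.smooth.differentiable (by simp)) (s := Ici 3) h.right
    (uniqueDiffOn_Ici 3 w hw) hw

/-- Vanishing to infinite order at `0`: the derivative is again such a bump, and the mean value
inequality gains one power of `w` each time. -/
theorem FlatBump.abs_le_mul_pow {η : ℝ → ℝ} (h : FlatBump η) (l : ℕ) :
    ∃ C, 0 ≤ C ∧ ∀ w, 0 ≤ w → |η w| ≤ C * w ^ l := by
  induction l generalizing η with
  | zero =>
    obtain ⟨C, hC⟩ := isCompact_Icc.exists_bound_of_continuousOn (s := Icc (0 : ℝ) 3)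
      h.smooth.continuous.continuousOn
    refine ⟨max C 0, le_max_right _ _, fun w hw => ?_⟩
    rw [pow_zero, mul_one]
    rcases le_total w 3 with h3 | h3
    · exact (hC w ⟨hw, h3⟩).trans (le_max_left _ _)
    · rw [h.right w h3, abs_zero]
      exact le_max_right _ _
  | succ l ih =>
    obtain ⟨C, hC0, hC⟩ := ih h.deriv
    refine ⟨C, hC0, fun w hw => ?_⟩
    have := (convex_Icc 0 w).norm_image_sub_le_of_norm_deriv_le (f := η) (C := C * w ^ l)
      (x := 0) (y := w) (fun x _ => h.smooth.differentiable (by simp) x) (fun x hx => by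
        refine (hC x hx.1).trans ?_
        have := pow_le_pow_left₀ hx.1 hx.2 l
        gcongr) ⟨le_rfl, hw⟩ ⟨hw, le_rfl⟩
    rw [h.left 0 le_rfl, sub_zero, sub_zero, Real.norm_eq_abs, Real.norm_of_nonneg hw] at this
    rw [pow_succ, ← mul_assoc]
    exact this

/-- For `w > 0`, `(w + c) ^ l ≥ w ^ l`, and flatness absorbs `w ^ l`. The constant is therefore
independent of `c`, and `c = 0`, where the denominator vanishes at the edge of the support, is
included. -/
theorem FlatBump.abs_div_le {η : ℝ → ℝ} (h : FlatBump η) (l m : ℕ) :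
    ∃ C, 0 ≤ C ∧ ∀ c, 0 ≤ c → ∀ w, |η w / (w + c) ^ l| ≤ C * |w| ^ m := by
  obtain ⟨C, hC0, hC⟩ := h.abs_le_mul_pow (l + m)
  refine ⟨C, hC0, fun c hc w => ?_⟩
  rcases le_or_gt w 0 with hw | hw
  · rw [h.left w hw]
    simp only [zero_div, abs_zero]
    positivity
  · rw [abs_div, abs_of_pos (pow_pos (by linarith : 0 < w + c) l), abs_of_pos hw,
      div_le_iff₀ (by positivity)]
    have h1 : w ^ l ≤ (w + c) ^ l := pow_le_pow_left₀ hw.le (by linarith) l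
    calc |η w| ≤ C * w ^ (l + m) := hC w hw.le
      _ = C * w ^ m * w ^ l := by ring
      _ ≤ _ := by gcongr

theorem FlatBump.hasDerivAt_div {η : ℝ → ℝ} (h : FlatBump η) (l : ℕ) {c : ℝ} (hc : 0 ≤ c) (w : ℝ) :
    HasDerivAt (fun w => η w / (w + c) ^ l)
      (_root_.deriv η w / (w + c) ^ l - l * (η w / (w + c) ^ (l + 1))) w := by
  rcases lt_trichotomy w 0 with hw | rfl | hw
  · rw [h.left w hw.le, h.deriv.left w hw.le]
    simp only [zero_div, mul_zero, sub_zero]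
    refine (hasDerivAt_const w (0 : ℝ)).congr_of_eventuallyEq ?_
    filter_upwards [Iio_mem_nhds hw] with x hx
    rw [h.left x (le_of_lt hx), zero_div]
  -- This is the only delicate point when `c = 0`: the quotient is `O(w²)`, hence differentiable
  -- with derivative zero.
  · rw [h.left 0 le_rfl, h.deriv.left 0 le_rfl]
    simp only [zero_div, mul_zero, sub_zero]
    obtain ⟨C, hC0, hC⟩ := h.abs_div_le l 2
    rw [hasDerivAt_iff_isLittleO]
    simp only [h.left 0 le_rfl, zero_div, sub_zero, smul_zero]
    refine Asymptotics.IsBigO.trans_isLittleO (g := fun x : ℝ => x ^ 2) ?_ ?_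
    · refine Asymptotics.IsBigO.of_bound C (Eventually.of_forall fun x => ?_)
      rw [Real.norm_eq_abs, Real.norm_of_nonneg (sq_nonneg x), ← sq_abs x]
      exact hC c hc x
    · exact Asymptotics.isLittleO_pow_id (by norm_num)
  · have hne : w + c ≠ 0 := by positivity
    have h1 : HasDerivAt η (_root_.deriv η w) w :=
      (h.smooth.differentiable (by simp) w).hasDerivAt
    have h2 : HasDerivAt (fun w : ℝ => (w + c) ^ l) (l * (w + c) ^ (l - 1) * 1) w :=
      ((hasDerivAt_id w).add_const c).pow l
    refine (h1.div h2 (pow_ne_zero l hne)).congr_deriv ?_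
    rcases l with _ | l
    · simp
    · simp only [Nat.add_sub_cancel]
      push_cast
      field_simp
      ring

theorem FlatBump.contDiff_div {η : ℝ → ℝ} (h : FlatBump η) (l : ℕ) {c : ℝ} (hc : 0 ≤ c) :
    ContDiff ℝ ∞ fun w => η w / (w + c) ^ l := by
  rw [contDiff_infty]
  intro j
  induction j generalizing η l with
  | zero =>
    exact_mod_cast contDiff_zero.2 (continuous_iff_continuousAt.2 fun w =>
      (h.hasDerivAt_div l hc w).continuousAt)
  | succ j ih =>
    have : ((j + 1 : ℕ) : WithTop ℕ∞) = (j : WithTop ℕ∞) + 1 := by push_cast; rfl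
    rw [this, contDiff_succ_iff_deriv]
    refine ⟨fun w => (h.hasDerivAt_div l hc w).differentiableAt, by simp, ?_⟩
    rw [funext fun w => (h.hasDerivAt_div l hc w).deriv]
    exact (ih h.deriv l).sub (contDiff_const.mul (ih h (l + 1)))

/-- Differentiation produces quotients of the same kind, with `η'` in the numerator or a higher
power in the denominator, so uniformity in `c` survives the induction. -/
theorem FlatBump.abs_iteratedDeriv_div_le {η : ℝ → ℝ} (h : FlatBump η) (j l : ℕ) :
    ∃ C, 0 ≤ C ∧ ∀ c, 0 ≤ c → ∀ w, |iteratedDeriv j (fun w => η w / (w + c) ^ l) w| ≤ C := by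
  induction j generalizing η l with
  | zero =>
    obtain ⟨C, hC0, hC⟩ := h.abs_div_le l 0
    exact ⟨C, hC0, fun c hc w => by simpa using hC c hc w⟩
  | succ j ih =>
    obtain ⟨C₁, h₁0, h₁⟩ := ih h.deriv l
    obtain ⟨C₂, h₂0, h₂⟩ := ih h (l + 1)
    refine ⟨C₁ + l * C₂, by positivity, fun c hc w => ?_⟩
    rw [iteratedDeriv_succ', funext fun w => (h.hasDerivAt_div l hc w).deriv]
    have e1 := (h.deriv.contDiff_div l hc).of_le (m := (j : ℕ)) (by exact_mod_cast le_top)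
    have e2 := (h.contDiff_div (l + 1) hc).of_le (m := (j : ℕ)) (by exact_mod_cast le_top)
    rw [iteratedDeriv_fun_sub e1.contDiffAt (contDiff_const.mul e2).contDiffAt,
      iteratedDeriv_const_mul_field]
    refine (abs_sub _ _).trans (add_le_add (h₁ c hc w) ?_)
    rw [abs_mul, Nat.abs_cast]
    exact mul_le_mul_of_nonneg_left (h₂ c hc w) (by positivity)

/-- The derivative of the cutoff profile, shifted so that it starts at the origin. -/
def cutoffSlope (K : ℝ → ℝ) (w : ℝ) : ℝ :=
  -2 * (1 + w) * deriv K (1 + w) * Real.smoothTransition (1 + w)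

theorem IsCutoff.deriv_eq_zero_left {K : ℝ → ℝ} (hK : IsCutoff K) {z : ℝ} (h0 : 0 ≤ z)
    (h1 : z ≤ 1) : deriv K z = 0 :=
  deriv_eq_zero_of_const_on (hK.smooth.differentiable (by simp)) (s := Icc 0 1)
    (fun z hz => hK.eq_one z hz.1 hz.2) (uniqueDiffOn_Icc (by norm_num) z ⟨h0, h1⟩) ⟨h0, h1⟩

theorem IsCutoff.flatBump {K : ℝ → ℝ} (hK : IsCutoff K) : FlatBump (cutoffSlope K) where
  smooth := by
    have h1 : ContDiff ℝ ∞ (deriv K) := (contDiff_infty_iff_deriv.1 hK.smooth).2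
    have h2 : ContDiff ℝ ∞ Real.smoothTransition := Real.smoothTransition.contDiff
    unfold cutoffSlope
    fun_prop
  left w hw := by
    unfold cutoffSlope
    rcases le_total (1 + w) 0 with h | h
    · rw [Real.smoothTransition.zero_of_nonpos h, mul_zero]
    · rw [hK.deriv_eq_zero_left h (by linarith)]
      simp
  right w hw := by
    unfold cutoffSlope
    rw [deriv_eq_zero_of_const_on (hK.smooth.differentiable (by simp)) (s := Ici 4)
      (fun z hz => hK.eq_zero z hz) (uniqueDiffOn_Ici 4 _ (by simp; linarith))
      (by simp; linarith)]
    simp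

/-- The smooth transition only suppresses negative arguments, where `K` is unrestricted: on `[0, 1]`
the derivative of `K` vanishes, and beyond `1` the transition equals `1`. -/
theorem IsCutoff.cutoffSlope_eq {K : ℝ → ℝ} (hK : IsCutoff K) {z : ℝ} (hz : 0 ≤ z) :
    cutoffSlope K (z - 1) = -2 * z * deriv K z := by
  unfold cutoffSlope
  rw [add_sub_cancel]
  rcases le_total z 1 with h | h
  · rw [hK.deriv_eq_zero_left hz h]
    simp
  · rw [Real.smoothTransition.one_of_one_le h, mul_one]

/-- The profile of `d/dΛ Δ_Λ` at `Λ = 1`, for `B = c - 1`. -/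
def slopeProfile (K : ℝ → ℝ) (c : ℝ) (x : Momentum) : ℝ :=
  cutoffSlope K (‖x‖ ^ 2 - 1) / (‖x‖ ^ 2 - 1 + c) ^ 1

/-- Scaling to `Λ = 1` leaves `c = 1 + B / Λ ^ 2` as the only parameter, and `c ≥ 0` whenever `|B| ≤
Λ ^ 2`. -/
theorem propagatorDeriv_eq {K : ℝ → ℝ} (hK : IsCutoff K) (B : ℝ) {Λ : ℝ} (hΛ : 0 < Λ)
    (k : Momentum) :
    propagatorDeriv K B Λ k = (Λ ^ 3)⁻¹ * slopeProfile K (1 + B / Λ ^ 2) (Λ⁻¹ • k) := by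
  have hn : ‖Λ⁻¹ • k‖ ^ 2 = ‖k‖ ^ 2 / Λ ^ 2 := by
    rw [norm_smul, norm_inv, Real.norm_of_nonneg hΛ.le]
    field_simp
  have hd : HasDerivAt (fun s : ℝ => ‖k‖ ^ 2 / s ^ 2) (-2 * ‖k‖ ^ 2 / Λ ^ 3) Λ := by
    have := (hasDerivAt_const Λ (‖k‖ ^ 2)).div (hasDerivAt_pow 2 Λ) (by positivity)
    refine this.congr_deriv ?_
    field_simp
    ring
  have hKd : HasDerivAt K (deriv K (‖k‖ ^ 2 / Λ ^ 2)) (‖k‖ ^ 2 / Λ ^ 2) :=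
    (hK.smooth.differentiable (by simp) _).hasDerivAt
  have h := (HasDerivAt.comp Λ hKd hd).div_const (‖k‖ ^ 2 + B)
  unfold propagatorDeriv propagator slopeProfile
  refine h.deriv.trans ?_
  rw [hn, hK.cutoffSlope_eq (by positivity), pow_one]
  have hden : ‖k‖ ^ 2 / Λ ^ 2 - 1 + (1 + B / Λ ^ 2) = (‖k‖ ^ 2 + B) / Λ ^ 2 := by
    field_simp
    ring
  rw [hden]
  -- At a zero of the denominator both sides are `0` by the convention `x / 0 = 0`.
  rcases eq_or_ne (‖k‖ ^ 2 + B) 0 with h0 | h0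
  · simp [h0]
  · field_simp

theorem IsCutoff.contDiff_slopeProfile {K : ℝ → ℝ} (hK : IsCutoff K) {c : ℝ} (hc : 0 ≤ c) :
    ContDiff ℝ ∞ (slopeProfile K c) := by
  have h1 : ContDiff ℝ ∞ fun x : Momentum => ‖x‖ ^ 2 - 1 :=
    (contDiff_id.norm_sq ℝ).sub contDiff_const
  exact (hK.flatBump.contDiff_div 1 hc).comp h1

theorem IsCutoff.slopeProfile_eq_zero {K : ℝ → ℝ} (hK : IsCutoff K) {c : ℝ} {x : Momentum}
    (hx : 2 ≤ ‖x‖) : slopeProfile K c x = 0 := by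
  unfold slopeProfile
  rw [hK.flatBump.right _ (by nlinarith), zero_div]

theorem IsCutoff.slopeProfile_zero {K : ℝ → ℝ} (hK : IsCutoff K) (c : ℝ) :
    slopeProfile K c 0 = 0 := by
  unfold slopeProfile
  rw [hK.flatBump.left _ (by simp), zero_div]

theorem IsCutoff.iteratedFDeriv_slopeProfile_eq_zero {K : ℝ → ℝ} (hK : IsCutoff K) (c : ℝ)
    {x : Momentum} (hx : 2 < ‖x‖) (p : ℕ) : iteratedFDeriv ℝ p (slopeProfile K c) x = 0 := by
  have h : slopeProfile K c =ᶠ[𝓝 x] fun _ => 0 := by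
    filter_upwards [(continuous_norm.isOpen_preimage _ isOpen_Ioi).mem_nhds
      (show x ∈ norm ⁻¹' Ioi 2 from hx)] with y hy
    exact hK.slopeProfile_eq_zero (le_of_lt hy)
  rw [(h.iteratedFDeriv ℝ p).eq_of_nhds]
  exact congrFun iteratedFDeriv_fun_zero x

theorem IsCutoff.norm_iteratedFDeriv_slopeProfile_le {K : ℝ → ℝ} (hK : IsCutoff K) (p : ℕ) :
    ∃ C, 0 ≤ C ∧ ∀ c, 0 ≤ c → ∀ x, ‖iteratedFDeriv ℝ p (slopeProfile K c) x‖ ≤ C := by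
  choose C hC0 hC using fun j => hK.flatBump.abs_iteratedDeriv_div_le j 1
  have h1 : ContDiff ℝ ∞ fun x : Momentum => ‖x‖ ^ 2 - 1 :=
    (contDiff_id.norm_sq ℝ).sub contDiff_const
  have h2 : ∀ i : ℕ, ∃ M, ∀ x ∈ Metric.closedBall (0 : Momentum) 2,
      ‖iteratedFDeriv ℝ i (fun x : Momentum => ‖x‖ ^ 2 - 1) x‖ ≤ M := fun i =>
    (isCompact_closedBall _ _).exists_bound_of_continuousOn
      (h1.continuous_iteratedFDeriv (by exact_mod_cast le_top)).continuousOn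
  choose M hM using h2
  set C' := ∑ j ∈ Finset.range (p + 1), C j
  set D := 1 + ∑ j ∈ Finset.range (p + 1), |M j|
  have hD : 1 ≤ D := le_add_of_nonneg_right (by positivity)
  have hC' : 0 ≤ C' := Finset.sum_nonneg fun j _ => hC0 j
  refine ⟨p.factorial * C' * D ^ p, by positivity, fun c hc x => ?_⟩
  -- The inner function `‖x‖ ^ 2 - 1` has bounded derivatives only on bounded sets; outside radius
  -- `2` the profile is identically zero.
  rcases le_or_gt ‖x‖ 2 with hx | hx
  · refine norm_iteratedFDeriv_comp_le (g := fun w => cutoffSlope K w / (w + c) ^ 1)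
      (f := fun x : Momentum => ‖x‖ ^ 2 - 1) (hK.flatBump.contDiff_div 1 hc) h1
      (by exact_mod_cast le_top) x (fun i hi => ?_) fun i hi hip => ?_
    · rw [norm_iteratedFDeriv_eq_norm_iteratedDeriv]
      exact (hC i c hc _).trans (Finset.single_le_sum (f := C) (fun j _ => hC0 j)
        (Finset.mem_range_succ_iff.2 hi))
    · have h3 : |M i| ≤ ∑ j ∈ Finset.range (p + 1), |M j| :=
        Finset.single_le_sum (f := fun j => |M j|) (fun j _ => abs_nonneg _)
          (Finset.mem_range_succ_iff.2 hip)
      calc _ ≤ M i := hM i x (by simpa using hx)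
        _ ≤ D := (le_abs_self _).trans (h3.trans (by simp [D]))
        _ ≤ D ^ i := le_self_pow₀ hD (by omega)
  · rw [hK.iteratedFDeriv_slopeProfile_eq_zero c hx, norm_zero]
    positivity

theorem one_add_div_sq_nonneg {B Λ : ℝ} (hΛ : 0 < Λ) (hB : |B| ≤ Λ ^ 2) : 0 ≤ 1 + B / Λ ^ 2 := by
  have := (abs_le.1 hB).1
  have h : 0 ≤ (Λ ^ 2 + B) / Λ ^ 2 := div_nonneg (by linarith) (by positivity)
  rwa [add_div, div_self (by positivity)] at h

theorem IsCutoff.contDiff_propagatorDeriv {K : ℝ → ℝ} (hK : IsCutoff K) {B Λ : ℝ} (hΛ : 0 < Λ)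
    (hB : |B| ≤ Λ ^ 2) : ContDiff ℝ ∞ (propagatorDeriv K B Λ) := by
  rw [funext (propagatorDeriv_eq hK B hΛ)]
  have := hK.contDiff_slopeProfile (one_add_div_sq_nonneg hΛ hB)
  fun_prop

theorem IsCutoff.propagatorDeriv_eq_zero {K : ℝ → ℝ} (hK : IsCutoff K) (B : ℝ) {Λ : ℝ}
    (hΛ : 0 < Λ) {k : Momentum} (hk : 2 * Λ ≤ ‖k‖) : propagatorDeriv K B Λ k = 0 := by
  rw [propagatorDeriv_eq hK B hΛ, hK.slopeProfile_eq_zero, mul_zero]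
  rw [norm_smul, norm_inv, Real.norm_of_nonneg hΛ.le, le_inv_mul_iff₀ hΛ]
  linarith

/-- This removes the `A` term from the flow equation. -/
theorem IsCutoff.propagatorDeriv_zero {K : ℝ → ℝ} (hK : IsCutoff K) (B : ℝ) {Λ : ℝ}
    (hΛ : 0 < Λ) : propagatorDeriv K B Λ 0 = 0 := by
  rw [propagatorDeriv_eq hK B hΛ, smul_zero, hK.slopeProfile_zero, mul_zero]

theorem iteratedFDeriv_propagatorDeriv {K : ℝ → ℝ} (hK : IsCutoff K) {B Λ : ℝ} (hΛ : 0 < Λ)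
    (hB : |B| ≤ Λ ^ 2) (p : ℕ) (k : Momentum) :
    iteratedFDeriv ℝ p (propagatorDeriv K B Λ) k =
      ((Λ ^ 3)⁻¹ * Λ⁻¹ ^ p) • iteratedFDeriv ℝ p (slopeProfile K (1 + B / Λ ^ 2)) (Λ⁻¹ • k) := by
  have hs : ContDiff ℝ (p : ℕ) (slopeProfile K (1 + B / Λ ^ 2)) :=
    (hK.contDiff_slopeProfile (one_add_div_sq_nonneg hΛ hB)).of_le (by exact_mod_cast le_top)
  have h1 : propagatorDeriv K B Λ =
      (Λ ^ 3)⁻¹ • fun k => slopeProfile K (1 + B / Λ ^ 2) (Λ⁻¹ • k) := by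
    funext k
    exact propagatorDeriv_eq hK B hΛ k
  rw [h1, iteratedFDeriv_const_smul_apply (ContDiff.contDiffAt (by fun_prop)),
    iteratedFDeriv_comp_const_smul _ hs, mul_smul]

theorem IsCutoff.norm_iteratedFDeriv_propagatorDeriv_le {K : ℝ → ℝ} (hK : IsCutoff K) (p : ℕ) :
    ∃ C, 0 ≤ C ∧ ∀ B Λ, 0 < Λ → |B| ≤ Λ ^ 2 → ∀ k,
      ‖iteratedFDeriv ℝ p (propagatorDeriv K B Λ) k‖ ≤ C * Λ ^ (-3 - p : ℤ) := by
  obtain ⟨C, hC0, hC⟩ := hK.norm_iteratedFDeriv_slopeProfile_le p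
  refine ⟨C, hC0, fun B Λ hΛ hB k => ?_⟩
  rw [iteratedFDeriv_propagatorDeriv hK hΛ hB, norm_smul, Real.norm_of_nonneg (by positivity),
    mul_comm C]
  have : (Λ ^ 3)⁻¹ * Λ⁻¹ ^ p = Λ ^ (-3 - p : ℤ) := by
    rw [zpow_sub₀ hΛ.ne', zpow_neg, zpow_natCast, div_eq_mul_inv, inv_pow]
    norm_cast
  rw [this]
  exact mul_le_mul_of_nonneg_left (hC _ (one_add_div_sq_nonneg hΛ hB) _) (by positivity)

theorem IsCutoff.iteratedFDeriv_propagatorDeriv_eq_zero {K : ℝ → ℝ} (hK : IsCutoff K) {B Λ : ℝ}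
    (hΛ : 0 < Λ) (hB : |B| ≤ Λ ^ 2) (p : ℕ) {k : Momentum} (hk : 2 * Λ < ‖k‖) :
    iteratedFDeriv ℝ p (propagatorDeriv K B Λ) k = 0 := by
  rw [iteratedFDeriv_propagatorDeriv hK hΛ hB, hK.iteratedFDeriv_slopeProfile_eq_zero, smul_zero]
  rw [norm_smul, norm_inv, Real.norm_of_nonneg hΛ.le, lt_inv_mul_iff₀ hΛ]
  linarith

end Propagator

/-! ### Polynomials with nonnegative coefficients -/

section NonnegCoeffs

open Polynomial

theorem NonnegCoeffs.add {P Q : ℝ[X]} (hP : NonnegCoeffs P) (hQ : NonnegCoeffs Q) :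
    NonnegCoeffs (P + Q) := fun m => by
  rw [coeff_add]
  exact add_nonneg (hP m) (hQ m)

theorem NonnegCoeffs.mul {P Q : ℝ[X]} (hP : NonnegCoeffs P) (hQ : NonnegCoeffs Q) :
    NonnegCoeffs (P * Q) := fun m => by
  rw [coeff_mul]
  exact Finset.sum_nonneg fun x _ => mul_nonneg (hP _) (hQ _)

theorem NonnegCoeffs.zero : NonnegCoeffs 0 := fun m => by simp

theorem NonnegCoeffs.const {c : ℝ} (hc : 0 ≤ c) : NonnegCoeffs (C c) := fun m => by
  rw [coeff_C]
  split_ifs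
  exacts [hc, le_rfl]

theorem NonnegCoeffs.X : NonnegCoeffs (X : ℝ[X]) := fun m => by
  rw [coeff_X]
  split_ifs <;> norm_num

theorem NonnegCoeffs.derivative {P : ℝ[X]} (hP : NonnegCoeffs P) :
    NonnegCoeffs (derivative P) := fun m => by
  rw [coeff_derivative]
  exact mul_nonneg (hP _) (by positivity)

theorem NonnegCoeffs.sum {ι : Type*} {s : Finset ι} {P : ι → ℝ[X]}
    (hP : ∀ i ∈ s, NonnegCoeffs (P i)) : NonnegCoeffs (∑ i ∈ s, P i) := fun m => by
  rw [finsetSum_coeff]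
  exact Finset.sum_nonneg fun i hi => hP i hi m

theorem NonnegCoeffs.eval_mono {P : ℝ[X]} (hP : NonnegCoeffs P) {x y : ℝ} (hx : 0 ≤ x)
    (hxy : x ≤ y) : P.eval x ≤ P.eval y := by
  rw [eval_eq_sum, eval_eq_sum, Polynomial.sum, Polynomial.sum]
  exact Finset.sum_le_sum fun i _ => mul_le_mul_of_nonneg_left (pow_le_pow_left₀ hx hxy i) (hP i)

theorem NonnegCoeffs.eval_nonneg {P : ℝ[X]} (hP : NonnegCoeffs P) {x : ℝ} (hx : 0 ≤ x) :
    0 ≤ P.eval x := by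
  rw [eval_eq_sum, Polynomial.sum]
  exact Finset.sum_nonneg fun i _ => mul_nonneg (hP i) (pow_nonneg hx i)

/-- Differentiation is nilpotent on a given polynomial, so `Q` is the finite geometric series `P +
P' + P'' + ⋯`. It gives the primitive `-Q(ln s) / s` of `P(ln s) / s ^ 2`. -/
theorem NonnegCoeffs.exists_sub_derivative_eq {P : ℝ[X]} (hP : NonnegCoeffs P) :
    ∃ Q : ℝ[X], NonnegCoeffs Q ∧ Q - Polynomial.derivative Q = P := by
  refine ⟨∑ i ∈ Finset.range (P.natDegree + 1), Polynomial.derivative^[i] P,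
    NonnegCoeffs.sum fun i _ => ?_, ?_⟩
  · clear * - hP
    induction i with
    | zero => exact hP
    | succ i ih =>
      rw [Function.iterate_succ_apply']
      exact ih.derivative
  · rw [derivative_sum, ← Finset.sum_sub_distrib]
    simp only [← Function.iterate_succ_apply' (f := ⇑Polynomial.derivative)]
    rw [Finset.sum_range_sub', iterate_derivative_eq_zero (Nat.lt_succ_self _)]
    simp

end NonnegCoeffs

/-! ### Power counting -/

/-- A solution of the flow equation together with the data and hypotheses of the boundedness
theorem. -/
structure FlowData (K : ℝ → ℝ) (N : (Fin 5 →₀ ℕ) → ℕ)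
    (P₀ : ℕ → ℕ → (Fin 5 →₀ ℕ) → Polynomial ℝ) where
  (A B Λ_R Λ₀ : ℝ)
  L : VertexFamily
  pos : 0 < Λ_R
  le : Λ_R ≤ Λ₀
  abs_B_le : |B| ≤ Λ_R ^ 2
  isFlow : IsPerturbativeFlow K A B Λ_R Λ₀ N L
  renormalization : RenormalizationConditions L Λ_R
  bare : BareConditions L Λ₀
  irrelevant : ∀ (n p : ℕ) (r : Fin 5 →₀ ℕ), 1 ≤ n → 6 ≤ n + p →
    RelDerivNormLE Λ₀ p (L.dimensionless r n Λ₀)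
      ((Λ₀ ^ p)⁻¹ * (Λ₀ / Λ_R) ^ (r 0) * (P₀ n p r).eval (Real.log (Λ₀ / Λ_R)))

section PowerCounting

variable {K : ℝ → ℝ} {N : (Fin 5 →₀ ℕ) → ℕ} {P₀ : ℕ → ℕ → (Fin 5 →₀ ℕ) → Polynomial ℝ}

namespace FlowData

variable (D : FlowData K N P₀)

/-- The range of scales of the flow. -/
def scales : Set ℝ := Icc D.Λ_R D.Λ₀

theorem left_mem : D.Λ_R ∈ D.scales := ⟨le_rfl, D.le⟩

theorem right_mem : D.Λ₀ ∈ D.scales := ⟨D.le, le_rfl⟩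

variable {D} in
theorem pos_of_mem {s : ℝ} (hs : s ∈ D.scales) : 0 < s := D.pos.trans_le hs.1

theorem pos₀ : 0 < D.Λ₀ := D.pos.trans_le D.le

variable {D} in
theorem abs_B_le_sq {s : ℝ} (hs : s ∈ D.scales) : |D.B| ≤ s ^ 2 :=
  D.abs_B_le.trans (pow_le_pow_left₀ D.pos.le hs.1 2)

/-- The dimensionful scale `Λ_R^{-r₁} Λ₀^{r_NR}` of the order `r`. -/
def weight (r : Fin 5 →₀ ℕ) : ℝ := (D.Λ_R ^ r 0)⁻¹ * D.Λ₀ ^ orderNR r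

theorem weight_pos (r : Fin 5 →₀ ℕ) : 0 < D.weight r := by
  have := D.pos
  have := D.pos₀
  unfold weight
  positivity

theorem weight_add (r r' : Fin 5 →₀ ℕ) : D.weight (r + r') = D.weight r * D.weight r' := by
  have h : orderNR (r + r') = orderNR r + orderNR r' := by simp [orderNR]; ring
  unfold weight
  rw [h, Finsupp.add_apply, pow_add, pow_add, mul_inv]
  ring

/-- `δ_{r_NR, 0} P(ln (Λ/Λ_R)) + (Λ/Λ₀) Q(ln (Λ₀/Λ_R))`. -/
def logFactor (r : Fin 5 →₀ ℕ) (P Q : Polynomial ℝ) (s : ℝ) : ℝ :=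
  (if orderNR r = 0 then P.eval (Real.log (s / D.Λ_R)) else 0) +
    s / D.Λ₀ * Q.eval (Real.log (D.Λ₀ / D.Λ_R))

variable {D}

theorem log_nonneg {s : ℝ} (hs : s ∈ D.scales) : 0 ≤ Real.log (s / D.Λ_R) :=
  Real.log_nonneg ((one_le_div D.pos).2 hs.1)

theorem log_mono {s t : ℝ} (hs : s ∈ D.scales) (hst : s ≤ t) :
    Real.log (s / D.Λ_R) ≤ Real.log (t / D.Λ_R) :=
  Real.log_le_log (div_pos (pos_of_mem hs) D.pos) (div_le_div_of_nonneg_right hst D.pos.le)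

theorem ratio_mem {s : ℝ} (hs : s ∈ D.scales) : s / D.Λ₀ ∈ Icc (0 : ℝ) 1 :=
  ⟨div_nonneg (pos_of_mem hs).le D.pos₀.le, (div_le_one D.pos₀).2 hs.2⟩

theorem logFactor_nonneg (r : Fin 5 →₀ ℕ) {P Q : Polynomial ℝ} (hP : NonnegCoeffs P)
    (hQ : NonnegCoeffs Q) {s : ℝ} (hs : s ∈ D.scales) : 0 ≤ D.logFactor r P Q s := by
  unfold logFactor
  have h1 := hP.eval_nonneg (log_nonneg hs)
  have h2 := hQ.eval_nonneg (log_nonneg D.right_mem)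
  have h3 := (ratio_mem hs).1
  split_ifs <;> positivity

theorem logFactor_mono (r : Fin 5 →₀ ℕ) {P Q : Polynomial ℝ} (hP : NonnegCoeffs P)
    (hQ : NonnegCoeffs Q) {s t : ℝ} (hs : s ∈ D.scales) (hst : s ≤ t) :
    D.logFactor r P Q s ≤ D.logFactor r P Q t := by
  unfold logFactor
  have h1 := hP.eval_mono (log_nonneg hs) (log_mono hs hst)
  have h2 := hQ.eval_nonneg (log_nonneg D.right_mem)
  have h3 : s / D.Λ₀ ≤ t / D.Λ₀ := div_le_div_of_nonneg_right hst D.pos₀.le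
  split_ifs <;> gcongr

/-- The product of the two leading terms survives only if `r_NR` vanishes for both orders, hence for
their sum. Every other product carries a factor `s / Λ₀ ≤ 1`, and its remaining logarithms can be
raised to `ln (Λ₀ / Λ_R)`. -/
theorem logFactor_mul_le (r r' : Fin 5 →₀ ℕ) {P Q P' Q' : Polynomial ℝ} (hP : NonnegCoeffs P)
    (hQ : NonnegCoeffs Q) (hP' : NonnegCoeffs P') (hQ' : NonnegCoeffs Q') {s : ℝ}
    (hs : s ∈ D.scales) :
    D.logFactor r P Q s * D.logFactor r' P' Q' s ≤
      D.logFactor (r + r') (P * P') (P * Q' + Q * P' + Q * Q') s := by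
  have hr : orderNR (r + r') = orderNR r + orderNR r' := by simp [orderNR]; ring
  have h1 := hP.eval_nonneg (log_nonneg hs)
  have h2 := hQ.eval_nonneg (log_nonneg D.right_mem)
  have h3 := hP'.eval_nonneg (log_nonneg hs)
  have h4 := hQ'.eval_nonneg (log_nonneg D.right_mem)
  have h5 := hP.eval_mono (log_nonneg hs) (log_mono hs hs.2)
  have h6 := hP'.eval_mono (log_nonneg hs) (log_mono hs hs.2)
  have h7 := ratio_mem hs
  unfold logFactor
  rw [hr]
  simp only [Polynomial.eval_add, Polynomial.eval_mul]
  set a := P.eval (Real.log (s / D.Λ_R))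
  set a' := P'.eval (Real.log (s / D.Λ_R))
  set b := Q.eval (Real.log (D.Λ₀ / D.Λ_R))
  set b' := Q'.eval (Real.log (D.Λ₀ / D.Λ_R))
  set u := P.eval (Real.log (D.Λ₀ / D.Λ_R))
  set u' := P'.eval (Real.log (D.Λ₀ / D.Λ_R))
  set x := s / D.Λ₀
  have hxx : x * x ≤ x := mul_le_of_le_one_left h7.1 h7.2
  have e1 : x * (a * b') ≤ x * (u * b') := by have := h7.1; gcongr
  have e2 : x * (b * a') ≤ x * (b * u') := by have := h7.1; gcongr
  have e3 : x * x * (b * b') ≤ x * (b * b') := by gcongr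
  have e4 : 0 ≤ x * (u * b') := mul_nonneg h7.1 (mul_nonneg (h1.trans h5) h4)
  have e5 : 0 ≤ x * (b * u') := mul_nonneg h7.1 (mul_nonneg h2 (h3.trans h6))
  by_cases c1 : orderNR r = 0 <;> by_cases c2 : orderNR r' = 0 <;>
    simp [c1, c2] <;> nlinarith

end FlowData

open FlowData

/-- `f` is nonnegative and bounded by `Λ^d Λ_R^{-r₁} Λ₀^{r_NR}` times
`δ_{r_NR, 0} Pln(Λ/Λ_R) + (Λ/Λ₀) Pln(Λ₀/Λ_R)`, uniformly in the flow. -/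
def PowerCounting (r : Fin 5 →₀ ℕ) (d : ℤ) (f : FlowData K N P₀ → ℝ → ℝ) : Prop :=
  ∃ P Q : Polynomial ℝ, NonnegCoeffs P ∧ NonnegCoeffs Q ∧ ∀ D, ∀ s ∈ D.scales,
    0 ≤ f D s ∧ f D s ≤ s ^ d * (D.weight r * D.logFactor r P Q s)

variable {r r' : Fin 5 →₀ ℕ} {d d' : ℤ} {f g : FlowData K N P₀ → ℝ → ℝ}

theorem PowerCounting.zero (r : Fin 5 →₀ ℕ) (d : ℤ) :
    PowerCounting r d (fun (_ : FlowData K N P₀) _ => 0) :=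
  ⟨0, 0, .zero, .zero, fun D s hs => by simp [logFactor]⟩

theorem PowerCounting.add (hf : PowerCounting r d f) (hg : PowerCounting r d g) :
    PowerCounting r d fun D s => f D s + g D s := by
  obtain ⟨P, Q, hP, hQ, hf⟩ := hf
  obtain ⟨P', Q', hP', hQ', hg⟩ := hg
  refine ⟨P + P', Q + Q', hP.add hP', hQ.add hQ', fun D s hs =>
    ⟨add_nonneg (hf D s hs).1 (hg D s hs).1, ?_⟩⟩
  refine (add_le_add (hf D s hs).2 (hg D s hs).2).trans_eq ?_
  unfold logFactor
  simp only [Polynomial.eval_add]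
  split_ifs <;> ring

theorem PowerCounting.sum {ι : Type*} {t : Finset ι} {f : ι → FlowData K N P₀ → ℝ → ℝ}
    (hf : ∀ i ∈ t, PowerCounting r d (f i)) :
    PowerCounting r d fun D s => ∑ i ∈ t, f i D s := by
  classical
  induction t using Finset.induction_on with
  | empty => simpa using PowerCounting.zero r d
  | insert a t ha ih =>
    simp only [Finset.sum_insert ha]
    exact (hf a (Finset.mem_insert_self _ _)).add
      (ih fun i hi => hf i (Finset.mem_insert_of_mem hi))

theorem PowerCounting.mul (hf : PowerCounting r d f) (hg : PowerCounting r' d' g) :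
    PowerCounting (r + r') (d + d') fun D s => f D s * g D s := by
  obtain ⟨P, Q, hP, hQ, hf⟩ := hf
  obtain ⟨P', Q', hP', hQ', hg⟩ := hg
  refine ⟨P * P', P * Q' + Q * P' + Q * Q', hP.mul hP',
    ((hP.mul hQ').add (hQ.mul hP')).add (hQ.mul hQ'), fun D s hs =>
    ⟨mul_nonneg (hf D s hs).1 (hg D s hs).1, ?_⟩⟩
  have hs0 := pos_of_mem hs
  have w := D.weight_pos r
  have w' := D.weight_pos r'
  calc f D s * g D s
      ≤ (s ^ d * (D.weight r * D.logFactor r P Q s)) *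
          (s ^ d' * (D.weight r' * D.logFactor r' P' Q' s)) :=
        mul_le_mul (hf D s hs).2 (hg D s hs).2 (hg D s hs).1
          ((hf D s hs).1.trans (hf D s hs).2)
    _ = s ^ (d + d') * (D.weight (r + r') *
          (D.logFactor r P Q s * D.logFactor r' P' Q' s)) := by
        rw [zpow_add₀ hs0.ne', weight_add]
        ring
    _ ≤ _ := by
        have := D.weight_pos (r + r')
        have := logFactor_mul_le r r' hP hQ hP' hQ' hs
        gcongr

theorem PowerCounting.const_mul_zpow (hf : PowerCounting r d f) {c : ℝ} (hc : 0 ≤ c) (m : ℤ) :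
    PowerCounting r (d + m) fun D s => c * s ^ m * f D s := by
  obtain ⟨P, Q, hP, hQ, hf⟩ := hf
  refine ⟨Polynomial.C c * P, Polynomial.C c * Q, (NonnegCoeffs.const hc).mul hP, (NonnegCoeffs.const hc).mul hQ,
    fun D s hs => ?_⟩
  have hs0 := pos_of_mem hs
  have h0 := (hf D s hs).1
  refine ⟨by positivity, ?_⟩
  calc c * s ^ m * f D s ≤ c * s ^ m * (s ^ d * (D.weight r * D.logFactor r P Q s)) := by
        have := (hf D s hs).2
        gcongr
    _ = _ := by
        rw [zpow_add₀ hs0.ne']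
        unfold logFactor
        simp only [Polynomial.eval_mul, Polynomial.eval_C]
        split_ifs <;> ring

theorem PowerCounting.const_mul (hf : PowerCounting r d f) {c : ℝ} (hc : 0 ≤ c) :
    PowerCounting r d fun D s => c * f D s := by
  simpa using hf.const_mul_zpow hc 0

/-- Comparison with an explicit primitive `M` of the majorant replaces integration of the flow, so
no integrability of `F'` in the scale is needed. -/
theorem abs_sub_le_of_hasDerivWithinAt (D : FlowData K N P₀) {a b : ℝ} (ha : a ∈ D.scales)
    (hb : b ∈ D.scales) (hab : a ≤ b) {F F' M M' : ℝ → ℝ}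
    (hF : ∀ s ∈ D.scales, HasDerivWithinAt F (F' s) D.scales s)
    (hM : ∀ s ∈ Icc a b, HasDerivAt M (M' s) s) (h0 : M a = 0)
    (h : ∀ s ∈ Icc a b, |F' s| ≤ M' s) : |F b - F a| ≤ M b := by
  have hsub : ∀ s ∈ Icc a b, s ∈ D.scales := fun s hs => ⟨ha.1.trans hs.1, hs.2.trans hb.2⟩
  refine image_norm_le_of_norm_deriv_right_le_deriv_boundary' (f := fun s => F s - F a) (f' := F')
    (a := a) (b := b) (B := M) (B' := M') ?_ ?_ ?_ ?_ ?_ ?_ ⟨hab, le_rfl⟩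
  · exact fun s hs => (((hF s (hsub s hs)).continuousWithinAt).mono hsub).sub
      continuousWithinAt_const
  · intro s hs
    have hs' : s ∈ Ico D.Λ_R D.Λ₀ := ⟨ha.1.trans hs.1, hs.2.trans_le hb.2⟩
    exact ((hF s (hsub s ⟨hs.1, hs.2.le⟩)).mono_of_mem_nhdsWithin
      (Icc_mem_nhdsGE_of_mem hs')).sub_const _
  · simp [h0]
  · exact fun s hs => (hM s hs).continuousAt.continuousWithinAt
  · exact fun s hs => (hM s ⟨hs.1, hs.2.le⟩).hasDerivWithinAt
  · exact fun s hs => h s ⟨hs.1, hs.2.le⟩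

/-- Integrating a bound on the flow upwards from `Λ_R`. -/
theorem PowerCounting.integrate_up (hg : PowerCounting r (d - 1) g) (hd : 0 ≤ d) :
    ∃ J, PowerCounting r d J ∧ ∀ D : FlowData K N P₀, ∀ Λ ∈ D.scales, ∀ (F F' : ℝ → ℝ) (c : ℝ),
      0 ≤ c → (∀ s ∈ D.scales, HasDerivWithinAt F (F' s) D.scales s) →
      (∀ s ∈ Icc D.Λ_R Λ, |F' s| ≤ c * g D s) → |F Λ - F D.Λ_R| ≤ c * J D Λ := by
  obtain ⟨P, Q, hP, hQ, hg⟩ := hg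
  refine ⟨fun D s => s ^ d * (D.weight r * D.logFactor r (P * Polynomial.X) (Q * Polynomial.X) s),
    ⟨P * Polynomial.X, Q * Polynomial.X, hP.mul .X, hQ.mul .X, fun D s hs => ⟨?_, le_rfl⟩⟩, ?_⟩
  · have := pos_of_mem hs
    have := D.weight_pos r
    have := logFactor_nonneg r (hP.mul .X) (hQ.mul .X) hs
    positivity
  intro D Λ hΛ F F' c hc hF hF'
  have hΛ0 := pos_of_mem hΛ
  have hw := D.weight_pos r
  -- Since `d ≥ 0`, everything except `1 / s` increases with `s` and is frozen at `Λ`. The integral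
  -- of `1 / s` costs one logarithm, hence the factors `X` in the polynomials.
  set M : ℝ := c * (Λ ^ d * (D.weight r * D.logFactor r P Q Λ)) with hM
  have h1 := abs_sub_le_of_hasDerivWithinAt D D.left_mem hΛ hΛ.1 hF
    (M := fun s => M * (Real.log s - Real.log D.Λ_R)) (M' := fun s => M * s⁻¹)
    (fun s hs => by
      have hs0 : s ≠ 0 := (D.pos.trans_le hs.1).ne'
      exact ((Real.hasDerivAt_log hs0).sub_const _).const_mul M) (by simp)
    (fun s hs => by
      have hs' : s ∈ D.scales := ⟨hs.1, hs.2.trans hΛ.2⟩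
      have hs0 := pos_of_mem hs'
      have h2 := logFactor_mono r hP hQ hs' hs.2
      have h2' := logFactor_nonneg r hP hQ hs'
      have h3 : s ^ d ≤ Λ ^ d := zpow_le_zpow_left₀ hd hs0.le hs.2
      calc |F' s| ≤ c * g D s := hF' s hs
        _ ≤ c * (s ^ (d - 1) * (D.weight r * D.logFactor r P Q s)) := by
            have := (hg D s hs').2
            gcongr
        _ = c * (s ^ d * (D.weight r * D.logFactor r P Q s)) * s⁻¹ := by
            rw [zpow_sub_one₀ hs0.ne']
            ring
        _ ≤ M * s⁻¹ := by
            rw [hM]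
            gcongr)
  refine h1.trans ?_
  have hl : Real.log Λ - Real.log D.Λ_R = Real.log (Λ / D.Λ_R) :=
    (Real.log_div hΛ0.ne' D.pos.ne').symm
  have h4 : D.logFactor r P Q Λ * Real.log (Λ / D.Λ_R) ≤
      D.logFactor r (P * Polynomial.X) (Q * Polynomial.X) Λ := by
    have e1 := hQ.eval_nonneg (log_nonneg D.right_mem)
    have e2 := (ratio_mem hΛ).1
    have e3 : Λ / D.Λ₀ * Q.eval (Real.log (D.Λ₀ / D.Λ_R)) * Real.log (Λ / D.Λ_R) ≤
        Λ / D.Λ₀ * Q.eval (Real.log (D.Λ₀ / D.Λ_R)) * Real.log (D.Λ₀ / D.Λ_R) := by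
      have := log_mono hΛ hΛ.2
      gcongr
    unfold logFactor
    simp only [Polynomial.eval_mul, Polynomial.eval_X]
    split_ifs <;> linarith
  calc M * (Real.log Λ - Real.log D.Λ_R)
      = c * (Λ ^ d * (D.weight r * (D.logFactor r P Q Λ * Real.log (Λ / D.Λ_R)))) := by
        rw [hl, hM]
        ring
    _ ≤ c * (Λ ^ d * (D.weight r *
          D.logFactor r (P * Polynomial.X) (Q * Polynomial.X) Λ)) := by gcongr

/-- Integrating a bound on the flow downwards from `Λ₀`. -/
theorem PowerCounting.integrate_down (hg : PowerCounting r (d - 1) g) (hd : d ≤ -1) :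
    ∃ J, PowerCounting r d J ∧ ∀ D : FlowData K N P₀, ∀ Λ ∈ D.scales, ∀ (F F' : ℝ → ℝ) (c : ℝ),
      0 ≤ c → (∀ s ∈ D.scales, HasDerivWithinAt F (F' s) D.scales s) →
      (∀ s ∈ Icc Λ D.Λ₀, |F' s| ≤ c * g D s) → |F D.Λ₀ - F Λ| ≤ c * J D Λ := by
  obtain ⟨P, Q, hP, hQ, hg⟩ := hg
  obtain ⟨P', hP', hPP'⟩ := hP.exists_sub_derivative_eq
  refine ⟨fun D s => s ^ d * (D.weight r * D.logFactor r P' (Q * Polynomial.X) s),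
    ⟨P', Q * Polynomial.X, hP', hQ.mul .X, fun D s hs => ⟨?_, le_rfl⟩⟩, ?_⟩
  · have := pos_of_mem hs
    have := D.weight_pos r
    have := logFactor_nonneg r hP' (hQ.mul .X) hs
    positivity
  intro D Λ hΛ F F' c hc hF hF'
  have hΛ0 := pos_of_mem hΛ
  have hw := D.weight_pos r
  set q := Q.eval (Real.log (D.Λ₀ / D.Λ_R)) / D.Λ₀ with hq
  have hq0 : 0 ≤ q := div_nonneg (hQ.eval_nonneg (log_nonneg D.right_mem)) D.pos₀.le
  set δ : ℝ := if orderNR r = 0 then 1 else 0 with hδ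
  have hδ0 : 0 ≤ δ := by rw [hδ]; split_ifs <;> norm_num
  have hfac : ∀ (P Q : Polynomial ℝ) (s : ℝ), D.logFactor r P Q s =
      δ * P.eval (Real.log (s / D.Λ_R)) + s * (Q.eval (Real.log (D.Λ₀ / D.Λ_R)) / D.Λ₀) := by
    intro P Q s
    unfold logFactor
    rw [hδ]
    split_ifs <;> ring
  -- Write `s ^ (d - 1) = s ^ (d + 1) * s ^ (-2)` and freeze the first factor at `Λ`, as `d + 1 ≤
  -- 0`. Against `s ^ (-2)` the `P` term has an explicit primitive, while the `Q` term is linear in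
  -- `s` and yields a logarithm.
  set M : ℝ := c * (Λ ^ (d + 1) * D.weight r) with hM
  have hM0 : 0 ≤ M := by positivity
  have h1 := abs_sub_le_of_hasDerivWithinAt D hΛ D.right_mem hΛ.2 hF
    (M := fun s => M * (δ * (P'.eval (Real.log (Λ / D.Λ_R)) / Λ -
      P'.eval (Real.log (s / D.Λ_R)) / s) + q * (Real.log s - Real.log Λ)))
    (M' := fun s => M * (δ * (P.eval (Real.log (s / D.Λ_R)) / s ^ 2) + q * s⁻¹))
    (fun s hs => by
      have hs0 : s ≠ 0 := (hΛ0.trans_le hs.1).ne'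
      have e1 := Real.hasDerivAt_log hs0
      have e2 : HasDerivAt (fun s => Real.log (s / D.Λ_R)) s⁻¹ s := by
        have := (e1.sub_const (Real.log D.Λ_R))
        refine this.congr_of_eventuallyEq ?_
        filter_upwards [eventually_ne_nhds hs0] with y hy
        exact Real.log_div hy D.pos.ne'
      have e3 := ((P'.hasDerivAt (Real.log (s / D.Λ_R))).comp s e2).div (hasDerivAt_id s) hs0
      refine ((((e3.const_sub (P'.eval (Real.log (Λ / D.Λ_R)) / Λ)).const_mul δ).add
        ((e1.sub_const (Real.log Λ)).const_mul q)).const_mul M).congr_deriv ?_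
      rw [← hPP', Polynomial.eval_sub]
      simp only [id, Function.comp]
      field_simp
      ring) (by simp)
    (fun s hs => by
      have hs' : s ∈ D.scales := ⟨hΛ.1.trans hs.1, hs.2⟩
      have hs0 := pos_of_mem hs'
      have h2' := logFactor_nonneg r hP hQ hs'
      have h3 : s ^ (d + 1) ≤ Λ ^ (d + 1) := by
        have := zpow_le_zpow_left₀ (n := -(d + 1)) (by omega) hΛ0.le hs.1
        rw [zpow_neg, zpow_neg] at this
        exact (inv_le_inv₀ (by positivity) (by positivity)).1 this
      calc |F' s| ≤ c * g D s := hF' s hs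
        _ ≤ c * (s ^ (d - 1) * (D.weight r * D.logFactor r P Q s)) := by
            have := (hg D s hs').2
            gcongr
        _ = c * (s ^ (d + 1) * D.weight r) * (D.logFactor r P Q s / s ^ 2) := by
            have : d - 1 = d + 1 - 2 := by ring
            rw [this, zpow_sub₀ hs0.ne']
            norm_cast
            field_simp
        _ ≤ M * (D.logFactor r P Q s / s ^ 2) := by
            rw [hM]
            gcongr
        _ = _ := by
            rw [hfac, ← hq]
            field_simp)
  refine h1.trans ?_
  have hl : Real.log D.Λ₀ - Real.log Λ ≤ Real.log (D.Λ₀ / D.Λ_R) := by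
    rw [Real.log_div D.pos₀.ne' D.pos.ne']
    linarith [Real.log_le_log D.pos hΛ.1]
  have h5 : 0 ≤ P'.eval (Real.log (D.Λ₀ / D.Λ_R)) / D.Λ₀ :=
    div_nonneg (hP'.eval_nonneg (log_nonneg D.right_mem)) D.pos₀.le
  -- The contribution of the upper endpoint `Λ₀` is nonpositive and is dropped.
  calc M * (δ * (P'.eval (Real.log (Λ / D.Λ_R)) / Λ -
        P'.eval (Real.log (D.Λ₀ / D.Λ_R)) / D.Λ₀) + q * (Real.log D.Λ₀ - Real.log Λ))
      ≤ M * (δ * (P'.eval (Real.log (Λ / D.Λ_R)) / Λ) + q * Real.log (D.Λ₀ / D.Λ_R)) := by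
        gcongr
        linarith
    _ = c * (Λ ^ d * (D.weight r * D.logFactor r P' (Q * Polynomial.X) Λ)) := by
        rw [hfac, hM, hq, zpow_add_one₀ hΛ0.ne', Polynomial.eval_mul, Polynomial.eval_X]
        field_simp

end PowerCounting

/-! ### Momentum configurations -/

section MomConf

theorem MomConf.norm_le_iff {n : ℕ} {k : MomConf n} {c : ℝ} (hc : 0 ≤ c) :
    ‖k‖ ≤ c ↔ ∀ i, ‖k.1 i‖ ≤ c :=
  pi_norm_le_iff_of_nonneg hc

theorem norm_momentum_le {n : ℕ} (k : MomConf n) (i : Fin n) : ‖k.1 i‖ ≤ ‖k‖ :=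
  norm_le_pi_norm k.1 i

theorem MomConf.norm_sum_le {n : ℕ} (S : Finset (Fin n)) (k : MomConf n) :
    ‖∑ i ∈ S, k.1 i‖ ≤ n * ‖k‖ := by
  refine (norm_sum_le_of_le S fun i _ => norm_momentum_le k i).trans ?_
  rw [Finset.sum_const, nsmul_eq_mul]
  have : (S.card : ℝ) ≤ n := by exact_mod_cast (Finset.card_le_univ S).trans_eq (Fintype.card_fin n)
  gcongr

theorem norm_snoc_le {n : ℕ} {k : Fin n → Momentum} {q : Momentum} {c : ℝ} (hk : ∀ i, ‖k i‖ ≤ c)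
    (hq : ‖q‖ ≤ c) (i : Fin (n + 1)) :
    ‖Fin.snoc (α := fun _ => Momentum) k q i‖ ≤ c := by
  refine Fin.lastCases ?_ (fun i => ?_) i
  · rwa [Fin.snoc_last]
  · rw [Fin.snoc_castSucc]
    exact hk i

theorem snoc_add {n : ℕ} (k k' : Fin n → Momentum) (q q' : Momentum) :
    Fin.snoc (α := fun _ => Momentum) (k + k') (q + q') =
      Fin.snoc (α := fun _ => Momentum) k q + Fin.snoc (α := fun _ => Momentum) k' q' := by
  funext i
  refine Fin.lastCases ?_ (fun i => ?_) i <;> simp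

theorem snoc_smul {n : ℕ} (c : ℝ) (k : Fin n → Momentum) (q : Momentum) :
    Fin.snoc (α := fun _ => Momentum) (c • k) (c • q) =
      c • Fin.snoc (α := fun _ => Momentum) k q := by
  funext i
  refine Fin.lastCases ?_ (fun i => ?_) i <;> simp

theorem norm_legs_le {n : ℕ} (S : Finset (Fin n)) {k : MomConf n} {c : ℝ} (hc : 0 ≤ c)
    (hk : ‖k‖ ≤ c) (hS : ‖∑ i ∈ S, k.1 i‖ ≤ c) : ‖legs S k‖ ≤ c := by
  rw [MomConf.norm_le_iff hc]
  exact norm_snoc_le (fun i => (norm_momentum_le k _).trans hk) (by rwa [norm_neg])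

/-- `legs S` as a linear map. -/
def legsCLM {n : ℕ} (S : Finset (Fin n)) : MomConf n →L[ℝ] MomConf (S.card + 1) :=
  LinearMap.mkContinuous
    { toFun := legs S
      map_add' := fun k k' => by
        refine Subtype.ext ?_
        change _ = (legs S k).1 + (legs S k').1
        unfold legs
        rw [← snoc_add]
        simp [Finset.sum_add_distrib, add_comm]
        rfl
      map_smul' := fun c k => by
        refine Subtype.ext ?_
        change _ = c • (legs S k).1
        unfold legs
        rw [← snoc_smul]
        simp [Finset.smul_sum]
        rfl } (n + 1) fun k => by
    refine norm_legs_le S (by positivity) ?_ ?_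
    · nlinarith [norm_nonneg k, (Nat.cast_nonneg n : (0 : ℝ) ≤ n)]
    · nlinarith [MomConf.norm_sum_le S k, norm_nonneg k]

theorem norm_legsCLM_le {n : ℕ} (S : Finset (Fin n)) : ‖legsCLM S‖ ≤ n + 1 :=
  LinearMap.mkContinuous_norm_le _ (by positivity) _

/-- `k ↦ ∑_{i ∈ S} kᵢ` as a linear map. -/
def sumCLM {n : ℕ} (S : Finset (Fin n)) : MomConf n →L[ℝ] Momentum :=
  LinearMap.mkContinuous
    { toFun := fun k => ∑ i ∈ S, k.1 i
      map_add' := fun k k' => by simp [Finset.sum_add_distrib]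
      map_smul' := fun c k => by simp [Finset.smul_sum] } n (MomConf.norm_sum_le S)

theorem norm_sumCLM_le {n : ℕ} (S : Finset (Fin n)) : ‖sumCLM S‖ ≤ n :=
  LinearMap.mkContinuous_norm_le _ (by positivity) _

/-- `permute σ` as a linear map. -/
def permuteCLM {n : ℕ} (σ : Equiv.Perm (Fin n)) : MomConf n →L[ℝ] MomConf n :=
  LinearMap.mkContinuous
    { toFun := permute σ
      map_add' := fun _ _ => rfl
      map_smul' := fun _ _ => rfl } 1 fun k => by
    rw [one_mul]
    exact (MomConf.norm_le_iff (norm_nonneg k)).2 fun _ => norm_momentum_le k _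

theorem norm_permuteCLM_le {n : ℕ} (σ : Equiv.Perm (Fin n)) : ‖permuteCLM σ‖ ≤ 1 :=
  LinearMap.mkContinuous_norm_le _ zero_le_one _

theorem norm_permute_le {n : ℕ} (σ : Equiv.Perm (Fin n)) (k : MomConf n) :
    ‖permute σ k‖ ≤ ‖k‖ :=
  (MomConf.norm_le_iff (norm_nonneg k)).2 fun _ => norm_momentum_le k _

theorem norm_loopLegs_le {n : ℕ} {k : MomConf n} {q : Momentum} {c : ℝ} (hc : 0 ≤ c)
    (hk : ‖k‖ ≤ c) (hq : ‖q‖ ≤ c) : ‖loopLegs k q‖ ≤ c :=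
  (MomConf.norm_le_iff hc).2 <| norm_snoc_le
    (norm_snoc_le (fun i => (norm_momentum_le k i).trans hk) hq) (by rwa [norm_neg])

theorem loopLegs_add {n : ℕ} (k k' : MomConf n) (q q' : Momentum) :
    loopLegs (k + k') (q + q') = loopLegs k q + loopLegs k' q' := by
  refine Subtype.ext ?_
  change Fin.snoc (α := fun _ => Momentum) (Fin.snoc (α := fun _ => Momentum) (k.1 + k'.1) (q + q'))
    (-(q + q')) = (loopLegs k q).1 + (loopLegs k' q').1
  rw [neg_add, snoc_add, snoc_add]
  rfl

theorem loopLegs_smul {n : ℕ} (c : ℝ) (k : MomConf n) (q : Momentum) :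
    loopLegs (c • k) (c • q) = c • loopLegs k q := by
  refine Subtype.ext ?_
  change Fin.snoc (α := fun _ => Momentum) (Fin.snoc (α := fun _ => Momentum) (c • k.1) (c • q))
    (-(c • q)) = c • (loopLegs k q).1
  rw [← smul_neg, snoc_smul, snoc_smul]
  rfl

/-- `k ↦ (k, 0, 0)` as a linear map. -/
def padCLM (n : ℕ) : MomConf n →L[ℝ] MomConf (n + 2) :=
  LinearMap.mkContinuous
    { toFun := fun k => loopLegs k 0
      map_add' := fun k k' => by simpa using loopLegs_add k k' 0 0
      map_smul' := fun c k => by simpa using loopLegs_smul c k 0 } 1 fun k => by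
    rw [one_mul]
    exact norm_loopLegs_le (norm_nonneg k) le_rfl (by simp)

theorem norm_padCLM_le (n : ℕ) : ‖padCLM n‖ ≤ 1 :=
  LinearMap.mkContinuous_norm_le _ zero_le_one _

theorem loopLegs_eq {n : ℕ} (k : MomConf n) (q : Momentum) :
    loopLegs k q = padCLM n k + loopLegs 0 q := by
  have := loopLegs_add k 0 0 q
  rwa [add_zero, zero_add] at this

theorem continuous_loopLegs {n : ℕ} (k : MomConf n) : Continuous (loopLegs k) := by
  refine Continuous.subtype_mk (continuous_pi fun i => ?_) _
  refine Fin.lastCases ?_ (fun i => ?_) i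
  · simp only [Fin.snoc_last]
    fun_prop
  · simp only [Fin.snoc_castSucc]
    refine Fin.lastCases ?_ (fun i => ?_) i
    · simp only [Fin.snoc_last]
      fun_prop
    · simp only [Fin.snoc_castSucc]
      fun_prop

theorem norm_iteratedFDeriv_comp_clm_le {E F : Type*} [NormedAddCommGroup E] [NormedSpace ℝ E]
    [NormedAddCommGroup F] [NormedSpace ℝ F] {f : F → ℝ} (hf : ContDiff ℝ ∞ f) (g : E →L[ℝ] F)
    {M : ℝ} (hg : ‖g‖ ≤ M) (p : ℕ) (x : E) :
    ‖iteratedFDeriv ℝ p (fun y => f (g y)) x‖ ≤ M ^ p * ‖iteratedFDeriv ℝ p f (g x)‖ := by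
  have h := g.iteratedFDeriv_comp_right hf x (i := p) (by exact_mod_cast le_top)
  rw [show (fun y => f (g y)) = f ∘ g from rfl, h, mul_comm]
  refine (ContinuousMultilinearMap.norm_compContinuousLinearMap_le _ _).trans ?_
  rw [Finset.prod_const, Finset.card_univ, Fintype.card_fin]
  gcongr

theorem norm_relDir_le {n : ℕ} (i j : Fin n) (μ : Fin 4) : ‖relDir i j μ‖ ≤ 2 := by
  rw [MomConf.norm_le_iff zero_le_two]
  intro l
  have h : ∀ i : Fin n, ‖(Pi.single i (EuclideanSpace.single μ 1) : Fin n → Momentum) l‖ ≤ 1 := by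
    intro i
    rcases eq_or_ne l i with rfl | hl
    · simp
    · simp [Pi.single_eq_of_ne hl]
  calc _ ≤ _ := norm_sub_le _ _
    _ ≤ 1 + 1 := add_le_add (h i) (h j)
    _ = 2 := by norm_num

theorem relDir_self {n : ℕ} (i : Fin n) (μ : Fin 4) : relDir i i μ = 0 :=
  Subtype.ext (sub_self _)

/-- The terms along leg `j` add up to the total momentum, which is zero. Thus the directions
relative to one fixed leg span all configurations. -/
theorem MomConf.eq_sum_relDir {n : ℕ} (j : Fin n) (v : MomConf n) :
    v = ∑ x : Fin n × Fin 4, v.1 x.1 x.2 • relDir x.1 j x.2 := by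
  have hv : ∑ i, v.1 i = 0 := v.2
  refine Subtype.ext ?_
  funext l
  ext ν
  have h1 : ∑ i, v.1 i ν = 0 := by
    have := congrArg (fun w : Momentum => w ν) hv
    simpa using this
  have h2 : (∑ x : Fin n × Fin 4, v.1 x.1 x.2 • relDir x.1 j x.2).1 l ν =
      ∑ x : Fin n × Fin 4, v.1 x.1 x.2 * ((relDir x.1 j x.2).1 l ν) := by
    simp [Finset.sum_apply]
  have h3 : ∀ (i : Fin n) (μ : Fin 4), (relDir i j μ).1 l ν =
      (if i = l then if μ = ν then 1 else 0 else 0) -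
        (if j = l then if μ = ν then 1 else 0 else 0) := by
    intro i μ
    have h4 : ∀ i : Fin n, ((Pi.single i (EuclideanSpace.single μ 1) : Fin n → Momentum) l) ν =
        if i = l then if μ = ν then (1 : ℝ) else 0 else 0 := by
      intro i
      rcases eq_or_ne i l with rfl | hl
      · simp [eq_comm]
      · simp [hl]
    change ((Pi.single i (EuclideanSpace.single μ 1) : Fin n → Momentum) l) ν -
      ((Pi.single j (EuclideanSpace.single μ 1) : Fin n → Momentum) l) ν = _
    rw [h4, h4]
  rw [h2, Fintype.sum_prod_type]
  simp only [h3, mul_sub, Finset.sum_sub_distrib]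
  by_cases hj : j = l <;> simp [hj, h1]

/-- Expand each argument in the directions relative to leg `j`: there are `n * 4` terms per slot,
with coordinates bounded by the norm. This passes from the derivatives in the hypotheses to operator
norms. -/
theorem norm_le_of_relDir {n p : ℕ} (j : Fin n) (T : MomConf n [×p]→L[ℝ] ℝ) {C : ℝ} (hC : 0 ≤ C)
    (h : ∀ (i : Fin p → Fin n) (μ : Fin p → Fin 4),
      |T fun a => relDir (i a) j (μ a)| ≤ C) : ‖T‖ ≤ (n * 4) ^ p * C := by
  refine ContinuousMultilinearMap.opNorm_le_bound (by positivity) fun v => ?_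
  have hv : T v = ∑ x : Fin p → Fin n × Fin 4,
      T fun a => (v a).1 (x a).1 (x a).2 • relDir (x a).1 j (x a).2 := by
    rw [← ContinuousMultilinearMap.map_sum T
      (fun a (x : Fin n × Fin 4) => (v a).1 x.1 x.2 • relDir x.1 j x.2)]
    congr 1
    funext a
    exact MomConf.eq_sum_relDir j (v a)
  rw [hv]
  have hx : ∀ x : Fin p → Fin n × Fin 4,
      ‖T fun a => (v a).1 (x a).1 (x a).2 • relDir (x a).1 j (x a).2‖ ≤ C * ∏ a, ‖v a‖ := by
    intro x
    rw [T.map_smul_univ (fun a => (v a).1 (x a).1 (x a).2) fun a => relDir (x a).1 j (x a).2,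
      norm_smul, mul_comm, norm_prod]
    refine mul_le_mul (h _ _) ?_ (by positivity) hC
    exact Finset.prod_le_prod (fun _ _ => norm_nonneg _) fun a _ =>
      (PiLp.norm_apply_le _ _).trans (norm_momentum_le (v a) _)
  refine (norm_sum_le_of_le _ fun x _ => hx x).trans_eq ?_
  simp [mul_assoc]

theorem iteratedFDeriv_eq_zero_of_subsingleton {E : Type*} [NormedAddCommGroup E]
    [NormedSpace ℝ E] [Subsingleton E] (f : E → ℝ) {p : ℕ} (hp : p ≠ 0) (x : E) :
    iteratedFDeriv ℝ p f x = 0 := by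
  ext v
  obtain ⟨p, rfl⟩ := Nat.exists_eq_succ_of_ne_zero hp
  rw [Subsingleton.elim v 0]
  exact (iteratedFDeriv ℝ (p + 1) f x).map_zero

instance : Subsingleton (MomConf 1) where
  allEq k k' := by
    have h : ∀ k : MomConf 1, k.1 0 = 0 := fun k => by
      have : ∑ i, k.1 i = 0 := k.2
      simpa using this
    refine Subtype.ext (funext fun i => ?_)
    rw [Subsingleton.elim i 0, h k, h k']

theorem iteratedFDeriv_zero_of_even {E : Type*} [NormedAddCommGroup E] [NormedSpace ℝ E]
    {f : E → ℝ} (hf : ContDiff ℝ ∞ f) (h : ∀ x, f (-x) = f x) {p : ℕ} (hp : Odd p) :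
    iteratedFDeriv ℝ p f 0 = 0 := by
  have h1 := iteratedFDeriv_comp_const_smul (-1 : ℝ)
    (hf.of_le (m := (p : ℕ)) (by exact_mod_cast le_top))
  have h2 : (fun x => f ((-1 : ℝ) • x)) = f := by
    funext x
    rw [neg_one_smul, h]
  rw [h2] at h1
  have h3 := congrFun h1 0
  simp only [smul_zero, hp.neg_one_pow, neg_one_smul] at h3
  ext v
  have h4 := congrArg (fun T => T v) h3
  simp only [neg_apply] at h4
  rw [zero_apply]
  linarith

end MomConf

/-! ### Bounds on the right-hand side of the flow equation -/

section FlowBounds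

open FlowData

variable {K : ℝ → ℝ} {N : (Fin 5 →₀ ℕ) → ℕ} {P₀ : ℕ → ℕ → (Fin 5 →₀ ℕ) → Polynomial ℝ}

theorem VertexFamily.symmetrize_order (L : VertexFamily) (r : Fin 5 →₀ ℕ) (n : ℕ) (s : ℝ)
    (k : MomConf n) : L.symmetrize.order r n s k =
      (n.factorial : ℝ)⁻¹ * ∑ σ : Equiv.Perm (Fin n), L.order r n s (permute σ k) := by
  simp [VertexFamily.order, VertexFamily.symmetrize]

theorem FlowData.contDiff_order (D : FlowData K N P₀) {n : ℕ} (hn : 1 ≤ n) (r : Fin 5 →₀ ℕ) {s : ℝ}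
    (hs : s ∈ D.scales) : ContDiff ℝ ∞ (D.L.order r n s) :=
  D.isFlow.smooth n hn r s hs

theorem FlowData.contDiff_symmetrize_order (D : FlowData K N P₀) {n : ℕ} (hn : 1 ≤ n)
    (r : Fin 5 →₀ ℕ) {s : ℝ} (hs : s ∈ D.scales) : ContDiff ℝ ∞ (D.L.symmetrize.order r n s) := by
  rw [funext (D.L.symmetrize_order r n s)]
  exact contDiff_const.mul (ContDiff.sum fun σ _ =>
    (D.contDiff_order hn r hs).comp (permuteCLM σ).contDiff)

theorem FlowData.symmetrize_order_zero (D : FlowData K N P₀) {n : ℕ} (hn : 1 ≤ n) {s : ℝ}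
    (hs : s ∈ D.scales) (k : MomConf n) : D.L.symmetrize.order 0 n s k = 0 := by
  rw [VertexFamily.symmetrize_order]
  simp [D.isFlow.zeroth n hn _ s hs]

/-- Permutations preserve the sup-norm balls and averaging preserves bounds, so bounds on the
unsymmetrized kernels, which carry the boundary conditions, suffice for the right-hand side. -/
theorem FlowData.norm_iteratedFDeriv_symmetrize_le (D : FlowData K N P₀) {n : ℕ} (hn : 1 ≤ n)
    (r : Fin 5 →₀ ℕ) (p : ℕ) {s R C : ℝ} (hs : s ∈ D.scales)
    (h : ∀ k, ‖k‖ ≤ R → ‖iteratedFDeriv ℝ p (D.L.order r n s) k‖ ≤ C) {k : MomConf n}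
    (hk : ‖k‖ ≤ R) : ‖iteratedFDeriv ℝ p (D.L.symmetrize.order r n s) k‖ ≤ C := by
  have hL := D.contDiff_order hn r hs
  have hσ : ∀ σ : Equiv.Perm (Fin n),
      ContDiff ℝ (p : ℕ) (fun k : MomConf n => D.L.order r n s (permute σ k)) := fun σ =>
    (hL.comp (permuteCLM σ).contDiff).of_le (by exact_mod_cast le_top)
  have h1 : D.L.symmetrize.order r n s = (n.factorial : ℝ)⁻¹ •
      ∑ σ : Equiv.Perm (Fin n), fun k => D.L.order r n s (permute σ k) := by
    funext k
    rw [VertexFamily.symmetrize_order]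
    simp
  rw [h1, iteratedFDeriv_const_smul_apply
      (ContDiff.contDiffAt (by
        rw [Finset.sum_fn]
        exact ContDiff.sum fun σ _ => hσ σ)),
    iteratedFDeriv_sum_apply fun σ _ => (hσ σ).contDiffAt, norm_smul,
    Real.norm_of_nonneg (by positivity)]
  have h2 : ∀ σ : Equiv.Perm (Fin n),
      ‖iteratedFDeriv ℝ p (fun k : MomConf n => D.L.order r n s (permute σ k)) k‖ ≤ C := fun σ => by
    refine (norm_iteratedFDeriv_comp_clm_le hL (permuteCLM σ) (norm_permuteCLM_le σ) p k).trans ?_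
    rw [one_pow, one_mul]
    exact h _ ((norm_permute_le σ k).trans hk)
  calc _ ≤ (n.factorial : ℝ)⁻¹ * ∑ _σ : Equiv.Perm (Fin n), C := by
        gcongr
        exact norm_sum_le_of_le _ fun σ _ => h2 σ
    _ = C := by
        rw [Finset.sum_const, Finset.card_univ, Fintype.card_perm, Fintype.card_fin, nsmul_eq_mul]
        field_simp

/-- The bound of the theorem on the `p`-th derivatives of the `n`-point function at order `r`. -/
def VertexBound (K : ℝ → ℝ) (N : (Fin 5 →₀ ℕ) → ℕ)
    (P₀ : ℕ → ℕ → (Fin 5 →₀ ℕ) → Polynomial ℝ) (r : Fin 5 →₀ ℕ) (n p : ℕ) : Prop :=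
  ∃ f : FlowData K N P₀ → ℝ → ℝ, PowerCounting r (4 - n - p) f ∧ ∀ D, ∀ s ∈ D.scales,
    ∀ k : MomConf n, ‖k‖ ≤ 2 * s → ‖iteratedFDeriv ℝ p (D.L.order r n s) k‖ ≤ f D s

theorem norm_iteratedFDeriv_mul_le_of_le {E : Type*} [NormedAddCommGroup E] [NormedSpace ℝ E]
    {f g : E → ℝ} (hf : ContDiff ℝ ∞ f) (hg : ContDiff ℝ ∞ g) {a b : ℕ → ℝ} {x : E} {p : ℕ}
    (ha : ∀ i ≤ p, ‖iteratedFDeriv ℝ i f x‖ ≤ a i) (hb : ∀ i ≤ p, ‖iteratedFDeriv ℝ i g x‖ ≤ b i) :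
    ‖iteratedFDeriv ℝ p (fun y => f y * g y) x‖ ≤
      ∑ i ∈ Finset.range (p + 1), p.choose i * a i * b (p - i) := by
  refine (norm_iteratedFDeriv_mul_le hf hg x (n := p) (by exact_mod_cast le_top)).trans
    (Finset.sum_le_sum fun i hi => ?_)
  have hi' := Finset.mem_range_succ_iff.1 hi
  have h1 := ha i hi'
  have h2 := hb (p - i) (Nat.sub_le _ _)
  have h3 := (norm_nonneg _).trans h1
  gcongr

/-- Leibniz' rule. The vertices have `n + 2` legs together, giving dimension `8 - (n + 2) = 6 - n`;
the propagator contributes `-3`, and each derivative lowers the dimension by one. -/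
theorem tree_bound (hK : IsCutoff K) {r₁ r₂ : Fin 5 →₀ ℕ} {n : ℕ} (S : Finset (Fin n))
    (h₁ : ∀ p, VertexBound K N P₀ r₁ (S.card + 1) p)
    (h₂ : ∀ p, VertexBound K N P₀ r₂ (Sᶜ.card + 1) p) (p : ℕ) :
    ∃ f : FlowData K N P₀ → ℝ → ℝ, PowerCounting (r₁ + r₂) (4 - n - p - 1) f ∧
      ∀ D, ∀ s ∈ D.scales, FinDiffBound p (2 * s) (f D s) fun k : MomConf n =>
        propagatorDeriv K D.B s (∑ i ∈ S, k.1 i) *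
          (D.L.symmetrize.order r₁ (S.card + 1) s (legs S k) *
            D.L.symmetrize.order r₂ (Sᶜ.card + 1) s (legs Sᶜ k)) := by
  choose f₁ hf₁ hb₁ using h₁
  choose f₂ hf₂ hb₂ using h₂
  choose C hC0 hC using fun i => hK.norm_iteratedFDeriv_propagatorDeriv_le i
  have hcard : S.card + Sᶜ.card = n := by simp
  refine ⟨fun D s => ∑ i ∈ Finset.range (p + 1), p.choose i *
    ((n : ℝ) ^ i * (C i * s ^ (-3 - i : ℤ))) * ∑ j ∈ Finset.range (p - i + 1), (p - i).choose j *
      (((n : ℝ) + 1) ^ j * f₁ j D s) * (((n : ℝ) + 1) ^ (p - i - j) * f₂ (p - i - j) D s),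
    PowerCounting.sum fun i hi => ?_, fun D s hs => ?_⟩
  · have hi' := Finset.mem_range_succ_iff.1 hi
    have h3 : PowerCounting (K := K) (N := N) (P₀ := P₀) (r₁ + r₂) (6 - n - (p - i)) fun D s =>
        ∑ j ∈ Finset.range (p - i + 1), (p - i).choose j *
        (((n : ℝ) + 1) ^ j * f₁ j D s) * (((n : ℝ) + 1) ^ (p - i - j) * f₂ (p - i - j) D s) := by
      refine PowerCounting.sum fun j hj => ?_
      have hj' := Finset.mem_range_succ_iff.1 hj
      have h4 := ((hf₁ j).mul (hf₂ (p - i - j))).const_mul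
        (c := (p - i).choose j * ((n : ℝ) + 1) ^ j * ((n : ℝ) + 1) ^ (p - i - j)) (by positivity)
      convert h4 using 1
      · push_cast [Nat.cast_sub hj', Nat.cast_sub hi', ← hcard]
        ring
      · funext D s
        ring
    have h4 := h3.const_mul_zpow (c := p.choose i * (n : ℝ) ^ i * C i)
      (mul_nonneg (by positivity) (hC0 i)) (-3 - i)
    convert h4 using 1
    · ring
    · funext D s
      ring
  · have hs0 := pos_of_mem hs
    have hB := abs_B_le_sq hs
    have c0 : ContDiff ℝ ∞ (propagatorDeriv K D.B s) := hK.contDiff_propagatorDeriv hs0 hB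
    have c1 := D.contDiff_symmetrize_order (Nat.le_add_left 1 S.card) r₁ hs
    have c2 := D.contDiff_symmetrize_order (Nat.le_add_left 1 Sᶜ.card) r₂ hs
    have c1' : ContDiff ℝ ∞ fun k : MomConf n =>
        D.L.symmetrize.order r₁ (S.card + 1) s (legs S k) := c1.comp (legsCLM S).contDiff
    have c2' : ContDiff ℝ ∞ fun k : MomConf n =>
        D.L.symmetrize.order r₂ (Sᶜ.card + 1) s (legs Sᶜ k) := c2.comp (legsCLM Sᶜ).contDiff
    have c0' : ContDiff ℝ ∞ fun k : MomConf n => propagatorDeriv K D.B s (∑ i ∈ S, k.1 i) :=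
      c0.comp (sumCLM S).contDiff
    have hprop : ∀ i (k : MomConf n),
        ‖iteratedFDeriv ℝ i (fun k : MomConf n => propagatorDeriv K D.B s (∑ i ∈ S, k.1 i)) k‖ ≤
          (n : ℝ) ^ i * ‖iteratedFDeriv ℝ i (propagatorDeriv K D.B s) (∑ i ∈ S, k.1 i)‖ :=
      fun i k => norm_iteratedFDeriv_comp_clm_le c0 (sumCLM S) (norm_sumCLM_le S) i k
    refine FinDiffBound.of_norm_iteratedFDeriv_le (c0'.mul (c1'.mul c2')) fun k hk => ?_
    -- The vertex bounds need the internal momentum in the ball of radius `2 * s`; outside it the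
    -- propagator vanishes with all its derivatives.
    rcases le_or_gt ‖∑ i ∈ S, k.1 i‖ (2 * s) with hS | hS
    · have hS' : ‖∑ i ∈ Sᶜ, k.1 i‖ ≤ 2 * s := by
        have h0 : ∑ i, k.1 i = 0 := k.2
        rw [← Finset.sum_add_sum_compl S, add_eq_zero_iff_eq_neg'] at h0
        rwa [h0, norm_neg]
      refine norm_iteratedFDeriv_mul_le_of_le c0' (c1'.mul c2')
        (a := fun i => (n : ℝ) ^ i * (C i * s ^ (-3 - i : ℤ)))
        (b := fun m => ∑ j ∈ Finset.range (m + 1), m.choose j *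
          (((n : ℝ) + 1) ^ j * f₁ j D s) * (((n : ℝ) + 1) ^ (m - j) * f₂ (m - j) D s))
        (fun i _ => (hprop i k).trans (by have := hC i D.B s hs0 hB (∑ i ∈ S, k.1 i); gcongr))
        fun i _ => ?_
      refine norm_iteratedFDeriv_mul_le_of_le c1' c2' (a := fun j => ((n : ℝ) + 1) ^ j * f₁ j D s)
        (b := fun j => ((n : ℝ) + 1) ^ j * f₂ j D s) (fun j _ => ?_) fun j _ => ?_
      · refine (norm_iteratedFDeriv_comp_clm_le c1 (legsCLM S) (norm_legsCLM_le S) j k).trans ?_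
        gcongr
        exact D.norm_iteratedFDeriv_symmetrize_le (Nat.le_add_left 1 _) r₁ j hs (hb₁ j D s hs)
          (norm_legs_le S (by positivity) hk hS)
      · refine (norm_iteratedFDeriv_comp_clm_le c2 (legsCLM Sᶜ) (norm_legsCLM_le Sᶜ) j k).trans ?_
        gcongr
        exact D.norm_iteratedFDeriv_symmetrize_le (Nat.le_add_left 1 _) r₂ j hs (hb₂ j D s hs)
          (norm_legs_le Sᶜ (by positivity) hk hS')
    · refine (norm_iteratedFDeriv_mul_le_of_le c0' (c1'.mul c2') (a := fun _ => 0)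
        (b := fun m => ‖iteratedFDeriv ℝ m (fun k : MomConf n =>
          D.L.symmetrize.order r₁ (S.card + 1) s (legs S k) *
            D.L.symmetrize.order r₂ (Sᶜ.card + 1) s (legs Sᶜ k)) k‖)
        (fun i _ => ?_) fun i _ => le_rfl).trans ?_
      · refine (hprop i k).trans_eq ?_
        rw [hK.iteratedFDeriv_propagatorDeriv_eq_zero hs0 hB i hS, norm_zero, mul_zero]
      · simp only [mul_zero, zero_mul, Finset.sum_const_zero]
        refine Finset.sum_nonneg fun i _ => ?_
        have := hC0 i
        have h5 : ∀ j m, 0 ≤ ((n : ℝ) + 1) ^ j * f₁ j D s * (((n : ℝ) + 1) ^ m * f₂ m D s) := by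
          intro j m
          have e1 : 0 ≤ f₁ j D s := by
            obtain ⟨P, Q, -, -, h⟩ := hf₁ j
            exact (h D s hs).1
          have e2 : 0 ≤ f₂ m D s := by
            obtain ⟨P, Q, -, -, h⟩ := hf₂ m
            exact (h D s hs).1
          positivity
        refine mul_nonneg (by positivity) (Finset.sum_nonneg fun j _ => ?_)
        rw [mul_assoc]
        exact mul_nonneg (by positivity) (h5 _ _)

theorem integrable_loop (hK : IsCutoff K) (D : FlowData K N P₀) (r : Fin 5 →₀ ℕ) (n : ℕ) {s : ℝ}
    (hs : s ∈ D.scales) (k : MomConf n) : Integrable fun q : Momentum =>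
      D.L.symmetrize.order r (n + 2) s (loopLegs k q) * propagatorDeriv K D.B s q := by
  have hs0 := pos_of_mem hs
  refine Continuous.integrable_of_hasCompactSupport ?_
    (HasCompactSupport.intro (isCompact_closedBall 0 (2 * s)) fun q hq => ?_)
  · exact ((D.contDiff_symmetrize_order (by omega) r hs).continuous.comp
      (continuous_loopLegs k)).mul (hK.contDiff_propagatorDeriv hs0 (abs_B_le_sq hs)).continuous
  · rw [hK.propagatorDeriv_eq_zero D.B hs0, mul_zero]
    simpa using (not_le.1 (by simpa using hq)).le

/-- The two extra legs cost two powers of `s`. The loop momentum is confined to a ball of volume of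
order `s ^ 4` and the propagator is of order `s ^ (-3)`, which gives back one power. -/
theorem loop_bound (hK : IsCutoff K) {r : Fin 5 →₀ ℕ} {n p : ℕ}
    (h : VertexBound K N P₀ r (n + 2) p) :
    ∃ f : FlowData K N P₀ → ℝ → ℝ, PowerCounting r (4 - n - p - 1) f ∧
      ∀ D, ∀ s ∈ D.scales, FinDiffBound p (2 * s) (f D s) fun k : MomConf n =>
        ∫ q : Momentum, D.L.symmetrize.order r (n + 2) s (loopLegs k q) *
          propagatorDeriv K D.B s q := by
  obtain ⟨f, hf, hb⟩ := h
  obtain ⟨C, hC0, hC⟩ := hK.norm_iteratedFDeriv_propagatorDeriv_le 0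
  set V : ℝ := volume.real (Metric.ball (0 : Momentum) 1) with hV
  refine ⟨fun D s => V * 2 ^ 4 * C * s ^ (1 : ℤ) * f D s, ?_, fun D s hs => ?_⟩
  · convert hf.const_mul_zpow (c := V * 2 ^ 4 * C) (by positivity) 1 using 1
    push_cast
    ring
  · have hs0 := pos_of_mem hs
    have hB := abs_B_le_sq hs
    have c := D.contDiff_symmetrize_order (n := n + 2) (by omega) r hs
    have hint : ∫ q : Momentum, (Metric.closedBall (0 : Momentum) (2 * s)).indicator
        (fun _ => C * s ^ (-3 : ℤ) * f D s) q = V * 2 ^ 4 * C * s ^ (1 : ℤ) * f D s := by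
      rw [integral_indicator_const _ Metric.isClosed_closedBall.measurableSet, smul_eq_mul,
        measureReal_def, Measure.addHaar_closedBall _ _ (by positivity), ENNReal.toReal_mul,
        ENNReal.toReal_ofReal (by positivity), finrank_euclideanSpace_fin, ← measureReal_def, ← hV]
      have : s ^ (-3 : ℤ) = (s ^ 3)⁻¹ := by rw [zpow_neg]; norm_cast
      rw [this, zpow_one]
      field_simp
    change FinDiffBound p (2 * s) (V * 2 ^ 4 * C * s ^ (1 : ℤ) * f D s) _
    rw [← hint]
    refine FinDiffBound.integral (fun q => ?_) ?_ fun k => integrable_loop hK D r n hs k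
    · have c' : ContDiff ℝ ∞ fun k : MomConf (n + 2) =>
          D.L.symmetrize.order r (n + 2) s (k + loopLegs 0 q) := by fun_prop
      have e : (fun k : MomConf n => D.L.symmetrize.order r (n + 2) s (loopLegs k q) *
          propagatorDeriv K D.B s q) = fun k => propagatorDeriv K D.B s q *
            D.L.symmetrize.order r (n + 2) s (padCLM n k + loopLegs 0 q) := by
        funext k
        rw [mul_comm, ← loopLegs_eq]
      rw [e]
      by_cases hq : q ∈ Metric.closedBall (0 : Momentum) (2 * s)
      · have hq' : ‖q‖ ≤ 2 * s := by simpa using hq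
        have h1 : FinDiffBound p (2 * s) (f D s) fun k : MomConf n =>
            D.L.symmetrize.order r (n + 2) s (padCLM n k + loopLegs 0 q) := by
          refine FinDiffBound.of_norm_iteratedFDeriv_le (c'.comp (padCLM n).contDiff)
            fun k hk => ?_
          refine (norm_iteratedFDeriv_comp_clm_le c' (padCLM n) (norm_padCLM_le n) p k).trans ?_
          rw [one_pow, one_mul, iteratedFDeriv_comp_add_right, ← loopLegs_eq]
          exact D.norm_iteratedFDeriv_symmetrize_le (by omega) r p hs (hb D s hs)
            (norm_loopLegs_le (by positivity) hk hq')
        rw [indicator_of_mem hq]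
        refine (h1.const_mul _).mono le_rfl ?_
        have h2 := hC D.B s hs0 hB q
        simp only [norm_iteratedFDeriv_zero, Real.norm_eq_abs, Nat.cast_zero, sub_zero] at h2
        have h3 : 0 ≤ f D s := by
          obtain ⟨P, Q, -, -, h⟩ := hf
          exact (h D s hs).1
        gcongr
      · rw [indicator_of_notMem hq,
          hK.propagatorDeriv_eq_zero D.B hs0 (not_le.1 (by simpa using hq)).le]
        simp only [zero_mul]
        intro v x _
        rw [finDiff_zero_fun]
        simp
    · exact (integrable_indicator_iff Metric.isClosed_closedBall.measurableSet).2
        (integrableOn_const (measure_closedBall_lt_top).ne)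

theorem coeff_polchinskiRHS (hK : IsCutoff K) (D : FlowData K N P₀) (r : Fin 5 →₀ ℕ) (n : ℕ)
    {s : ℝ} (hs : s ∈ D.scales) (k : MomConf n) :
    MvPowerSeries.coeff r (polchinskiRHS K D.A D.B D.L.symmetrize n k s) =
      -(1 / 2) * (∑ S : Finset (Fin n), ∑ x ∈ Finset.HasAntidiagonal.antidiagonal r,
        propagatorDeriv K D.B s (∑ i ∈ S, k.1 i) *
          (D.L.symmetrize.order x.1 (S.card + 1) s (legs S k) *
            D.L.symmetrize.order x.2 (Sᶜ.card + 1) s (legs Sᶜ k))) +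
      -((1 / 2) * ((2 * Real.pi) ^ 4)⁻¹) * ∫ q : Momentum,
        D.L.symmetrize.order r (n + 2) s (loopLegs k q) * propagatorDeriv K D.B s q := by
  classical
  rw [MvPowerSeries.coeff_apply]
  unfold polchinskiRHS
  beta_reduce
  simp only [hK.propagatorDeriv_zero D.B (pos_of_mem hs), mul_zero, sub_zero]
  rw [sub_eq_add_neg,
    neg_mul (1 / 2 * _)]
  congr 2
  refine Finset.sum_congr rfl fun S _ => ?_
  rw [MvPowerSeries.coeff_mul, Finset.mul_sum]
  rfl

theorem flow_bound (hK : IsCutoff K) {r : Fin 5 →₀ ℕ} {n : ℕ}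
    (hr : ∀ r' : Fin 5 →₀ ℕ, ∑ i, r' i < ∑ i, r i → ∀ m, 1 ≤ m → ∀ p, VertexBound K N P₀ r' m p)
    (p : ℕ) (h : VertexBound K N P₀ r (n + 2) p) :
    ∃ f : FlowData K N P₀ → ℝ → ℝ, PowerCounting r (4 - n - p - 1) f ∧
      ∀ D, ∀ s ∈ D.scales, FinDiffBound p (2 * s) (f D s) fun k : MomConf n =>
        MvPowerSeries.coeff r (polchinskiRHS K D.A D.B D.L.symmetrize n k s) := by
  classical
  obtain ⟨f, hf, hb⟩ := loop_bound hK h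
  have ht : ∀ (S : Finset (Fin n)) (x : (Fin 5 →₀ ℕ) × (Fin 5 →₀ ℕ)),
      -- Membership is placed inside the existential so that `g` can be chosen for all pairs; off
      -- the antidiagonal it is a dummy value.
      ∃ g : FlowData K N P₀ → ℝ → ℝ, x ∈ Finset.HasAntidiagonal.antidiagonal r →
      PowerCounting r (4 - n - p - 1) g ∧
      ∀ D, ∀ s ∈ D.scales, FinDiffBound p (2 * s) (g D s) fun k : MomConf n =>
        propagatorDeriv K D.B s (∑ i ∈ S, k.1 i) *
          (D.L.symmetrize.order x.1 (S.card + 1) s (legs S k) *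
            D.L.symmetrize.order x.2 (Sᶜ.card + 1) s (legs Sᶜ k)) := by
    rintro S ⟨r₁, r₂⟩
    have hzero : ∀ D : FlowData K N P₀, ∀ s, (r₁ = 0 ∨ r₂ = 0) → s ∈ D.scales →
        FinDiffBound p (2 * s) 0 fun k : MomConf n =>
        propagatorDeriv K D.B s (∑ i ∈ S, k.1 i) *
          (D.L.symmetrize.order r₁ (S.card + 1) s (legs S k) *
            D.L.symmetrize.order r₂ (Sᶜ.card + 1) s (legs Sᶜ k)) := by
      intro D s h0 hs v x _
      have e : (fun k : MomConf n => propagatorDeriv K D.B s (∑ i ∈ S, k.1 i) *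
          (D.L.symmetrize.order r₁ (S.card + 1) s (legs S k) *
            D.L.symmetrize.order r₂ (Sᶜ.card + 1) s (legs Sᶜ k))) = fun _ => 0 := by
        funext k
        rcases h0 with rfl | rfl
        · rw [D.symmetrize_order_zero (Nat.le_add_left 1 _) hs, zero_mul, mul_zero]
        · rw [D.symmetrize_order_zero (Nat.le_add_left 1 _) hs, mul_zero, mul_zero]
      rw [e, finDiff_zero_fun]
      simp
    -- A factor of order zero kills the term. Otherwise both orders are strictly smaller than `r`,
    -- as the outer induction requires.
    by_cases h0 : r₁ = 0 ∨ r₂ = 0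
    · exact ⟨fun _ _ => 0, fun _ => ⟨PowerCounting.zero _ _, fun D s hs => hzero D s h0 hs⟩⟩
    · by_cases hx : (r₁, r₂) ∈ Finset.HasAntidiagonal.antidiagonal r
      · rw [not_or] at h0
        rw [Finset.HasAntidiagonal.mem_antidiagonal] at hx
        have hpos : ∀ r' : Fin 5 →₀ ℕ, r' ≠ 0 → 0 < ∑ i, r' i := by
          intro r' hr'
          refine Nat.pos_of_ne_zero fun h => hr' ?_
          ext i
          simpa using (Finset.sum_eq_zero_iff.1 h) i (Finset.mem_univ i)
        have hsum : ∑ i, r i = ∑ i, r₁ i + ∑ i, r₂ i := by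
          rw [← hx, ← Finset.sum_add_distrib]
          rfl
        have h1 := hpos r₁ h0.1
        have h2 := hpos r₂ h0.2
        obtain ⟨g, hg, hg'⟩ := tree_bound hK S (hr r₁ (by omega) _ (Nat.le_add_left 1 _))
          (hr r₂ (by omega) _ (Nat.le_add_left 1 _)) p
        have hx' : r₁ + r₂ = r := hx
        rw [hx'] at hg
        exact ⟨g, fun _ => ⟨hg, hg'⟩⟩
      · exact ⟨fun _ _ => 0, fun h => absurd h hx⟩
  choose g hg using ht
  refine ⟨fun D s => |(-(1 / 2) : ℝ)| * (∑ S : Finset (Fin n), ∑ x ∈ Finset.HasAntidiagonal.antidiagonal r,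
    g S x D s) + |(-((1 / 2) * ((2 * Real.pi) ^ 4)⁻¹) : ℝ)| * f D s, ?_, fun D s hs => ?_⟩
  · exact ((PowerCounting.sum fun S _ => PowerCounting.sum fun x hx =>
      (hg S x hx).1).const_mul (abs_nonneg _)).add (hf.const_mul (abs_nonneg _))
  · rw [funext (coeff_polchinskiRHS hK D r n hs)]
    exact ((FinDiffBound.sum fun S _ => FinDiffBound.sum fun x hx =>
      (hg S x hx).2 D s hs).const_mul _).add ((hb D s hs).const_mul _)

end FlowBounds

/-! ### Boundary values of the flow -/

section BoundaryValues

open FlowData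

variable {K : ℝ → ℝ} {N : (Fin 5 →₀ ℕ) → ℕ} {P₀ : ℕ → ℕ → (Fin 5 →₀ ℕ) → Polynomial ℝ}

theorem FlowData.iteratedFDeriv_zero_of_odd (D : FlowData K N P₀) {n : ℕ} (hn : 1 ≤ n)
    (r : Fin 5 →₀ ℕ) {p : ℕ} (hp : Odd p) {s : ℝ} (hs : s ∈ D.scales) :
    iteratedFDeriv ℝ p (D.L.order r n s) 0 = 0 := by
  refine iteratedFDeriv_zero_of_even (D.contDiff_order hn r hs) (fun k => ?_) hp
  have h := D.isFlow.invariant n hn (LinearIsometryEquiv.neg ℝ) k s hs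
  have hk : rotate (LinearIsometryEquiv.neg ℝ) k = -k := Subtype.ext (funext fun i => by
    simp [rotate])
  rw [hk] at h
  exact congrArg (MvPowerSeries.coeff r) h

/-- Directions relative to leg `j` suffice, and the one with `i = j` is zero, so the conditions on
the other legs determine the whole Hessian. -/
theorem FlowData.norm_hessian_zero_le (D : FlowData K N P₀) {n : ℕ} (j : Fin n)
    (r : Fin 5 →₀ ℕ) {s C : ℝ} (hC : 0 ≤ C)
    (h : ∀ (i i' : Fin n) (μ ν : Fin 4), i ≠ j → i' ≠ j →
      |MvPowerSeries.coeff r (D.L.hessianAtZero n s i j i' j μ ν)| ≤ C) :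
    ‖iteratedFDeriv ℝ 2 (D.L.order r n s) 0‖ ≤ (n * 4) ^ 2 * C := by
  refine norm_le_of_relDir j _ hC fun i μ => ?_
  have hz : ∀ a, i a = j →
      |iteratedFDeriv ℝ 2 (D.L.order r n s) 0 fun a => relDir (i a) j (μ a)| ≤ C := by
    intro a ha
    rw [ContinuousMultilinearMap.map_coord_zero _ a (by rw [ha, relDir_self]), abs_zero]
    exact hC
  by_cases h0 : i 0 = j
  · exact hz 0 h0
  by_cases h1 : i 1 = j
  · exact hz 1 h1
  convert h (i 0) (i 1) (μ 0) (μ 1) h0 h1 using 2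
  change _ = iteratedFDeriv ℝ 2 (D.L.order r n s) 0
    fun a => relDir (![i 0, i 1] a) (![j, j] a) (![μ 0, μ 1] a)
  congr 1
  funext a
  fin_cases a <;> rfl

/-- The size at `Λ_R` allowed for the relevant parameters of scaling dimension `d`. -/
def FlowData.initialBound (D : FlowData K N P₀) (r : Fin 5 →₀ ℕ) (d : ℤ) : ℝ :=
  if orderNR r = 0 then D.Λ_R ^ d * D.weight r else 0

theorem FlowData.initialBound_nonneg (D : FlowData K N P₀) (r : Fin 5 →₀ ℕ) (d : ℤ) :
    0 ≤ D.initialBound r d := by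
  have := D.pos
  have := D.weight_pos r
  unfold initialBound
  split_ifs <;> positivity

/-- Odd derivatives vanish by inversion and one-point derivatives trivially. Only `ρ₄ᴿ` and `ρ₅ᴿ`
give nonzero values; there `r_NR = 0` and the bound equals `1`. -/
theorem FlowData.norm_relevant_le (D : FlowData K N P₀) (r : Fin 5 →₀ ℕ) {n p : ℕ} (hn : 1 ≤ n)
    (hnp : n + p ≤ 4) :
    ‖iteratedFDeriv ℝ p (D.L.order r n D.Λ_R) 0‖ ≤ D.initialBound r (4 - n - p) := by
  have hb := D.initialBound_nonneg r (4 - n - p)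
  have hR := D.pos.ne'
  have hzero : iteratedFDeriv ℝ p (D.L.order r n D.Λ_R) 0 = 0 →
      ‖iteratedFDeriv ℝ p (D.L.order r n D.Λ_R) 0‖ ≤ D.initialBound r (4 - n - p) := by
    intro h
    rwa [h, norm_zero]
  have hX : ∀ (a : Fin 5) (n : ℕ), (a = 0 ∧ n = 3 ∨ a = 1 ∧ n = 4) →
      D.L n 0 D.Λ_R = MvPowerSeries.X a →
      ‖iteratedFDeriv ℝ 0 (D.L.order r n D.Λ_R) 0‖ ≤ D.initialBound r (4 - n - (0 : ℕ)) := by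
    intro a n h hX
    rw [norm_iteratedFDeriv_zero, VertexFamily.order, hX, MvPowerSeries.coeff_X]
    split_ifs with hr
    · unfold initialBound
      subst hr
      rcases h with ⟨rfl, rfl⟩ | ⟨rfl, rfl⟩ <;> simp [orderNR, weight, hR]
    · simpa using D.initialBound_nonneg r _
  obtain ⟨h1, h2, h3, h4, h5⟩ := D.renormalization
  by_cases hp : Odd p
  · exact hzero (D.iteratedFDeriv_zero_of_odd hn r hp D.left_mem)
  rcases eq_or_ne n 1 with rfl | hn1
  · rcases eq_or_ne p 0 with rfl | hp0
    · rw [norm_iteratedFDeriv_zero, VertexFamily.order, h1, map_zero, norm_zero]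
      exact hb
    · exact hzero (iteratedFDeriv_eq_zero_of_subsingleton _ hp0 0)
  have hcases : (n = 2 ∧ p = 0) ∨ (n = 2 ∧ p = 2) ∨ (n = 3 ∧ p = 0) ∨ (n = 4 ∧ p = 0) := by
    have : p ≠ 1 := by rintro rfl; exact hp odd_one
    omega
  rcases hcases with ⟨rfl, rfl⟩ | ⟨rfl, rfl⟩ | ⟨rfl, rfl⟩ | ⟨rfl, rfl⟩
  · rw [norm_iteratedFDeriv_zero, VertexFamily.order, h2, map_zero, norm_zero]
    exact hb
  · refine (D.norm_hessian_zero_le (1 : Fin 2) r le_rfl fun i i' μ ν hi hi' => ?_).trans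
      (by simpa using hb)
    have e : ∀ i : Fin 2, i ≠ 1 → i = 0 := by decide
    rw [e i hi, e i' hi', h3, map_zero, abs_zero]
  · exact hX 0 3 (by simp) h4
  · exact hX 1 4 (by simp) h5

/-- Parity and triviality leave the Hessian of `L₃` and `L₅(0)`. For a single bare coupling the
weight is `Λ₀`, so the bound without its constant is `1`; the constant `144 = (3 * 4) ^ 2` comes
from the Hessian. -/
theorem FlowData.norm_marginal_le (D : FlowData K N P₀) (r : Fin 5 →₀ ℕ) {n p : ℕ} (hn : 1 ≤ n)
    (hnp : n + p = 5) :
    ‖iteratedFDeriv ℝ p (D.L.order r n D.Λ₀) 0‖ ≤ 144 * (D.Λ₀ ^ (-1 : ℤ) * D.weight r) := by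
  have h0 := D.pos₀
  have hw := D.weight_pos r
  have hX : ∀ a : Fin 5, 2 ≤ a → |MvPowerSeries.coeff r (MvPowerSeries.X a : CouplingSeries)| ≤
      D.Λ₀ ^ (-1 : ℤ) * D.weight r := by
    intro a ha
    rw [MvPowerSeries.coeff_X]
    split_ifs with hr
    · have e : orderNR r = 1 ∧ r 0 = 0 := by
        subst hr
        fin_cases a <;> simp [orderNR] at ha ⊢
      unfold weight
      rw [e.1, e.2, abs_one]
      simp [h0.ne']
    · rw [abs_zero]
      positivity
  have hzero : iteratedFDeriv ℝ p (D.L.order r n D.Λ₀) 0 = 0 →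
      ‖iteratedFDeriv ℝ p (D.L.order r n D.Λ₀) 0‖ ≤ 144 * (D.Λ₀ ^ (-1 : ℤ) * D.weight r) := by
    intro h
    rw [h, norm_zero]
    positivity
  by_cases hp : Odd p
  · exact hzero (D.iteratedFDeriv_zero_of_odd hn r hp D.right_mem)
  have hcases : (n = 1 ∧ p = 4) ∨ (n = 3 ∧ p = 2) ∨ (n = 5 ∧ p = 0) := by
    have h1 : p ≠ 1 := by rintro rfl; exact hp odd_one
    have h3 : p ≠ 3 := by rintro rfl; exact hp (by decide)
    omega
  rcases hcases with ⟨rfl, rfl⟩ | ⟨rfl, rfl⟩ | ⟨rfl, rfl⟩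
  · exact hzero (iteratedFDeriv_eq_zero_of_subsingleton _ (by norm_num) 0)
  · refine (D.norm_hessian_zero_le (2 : Fin 3) r (C := D.Λ₀ ^ (-1 : ℤ) * D.weight r)
      (by positivity) fun i i' μ ν hi hi' => ?_).trans_eq (by norm_num)
    have hcoeff : ∀ a : Fin 5, 2 ≤ a →
        |MvPowerSeries.coeff r (if μ = ν then (MvPowerSeries.X a : CouplingSeries) else 0)| ≤
          D.Λ₀ ^ (-1 : ℤ) * D.weight r := by
      intro a ha
      split_ifs
      · exact hX a ha
      · rw [map_zero, abs_zero]
        positivity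
    rcases eq_or_ne i i' with rfl | hii
    · rw [D.bare.rho6 i hi]
      exact hcoeff 2 le_rfl
    · rw [D.bare.rho7 i i' hi hi' hii]
      exact hcoeff 3 (by decide)
  · rw [norm_iteratedFDeriv_zero, VertexFamily.order, D.bare.rho8, Real.norm_eq_abs]
    have := hX 4 (by decide)
    have h1 : 0 ≤ D.Λ₀ ^ (-1 : ℤ) * D.weight r := by positivity
    linarith

theorem FlowData.dimensionless_factor (D : FlowData K N P₀) (r : Fin 5 →₀ ℕ) (n p : ℕ) {s : ℝ}
    (hs : s ∈ D.scales) :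
    s ^ ((n : ℤ) - 4 + (r 0 : ℤ) - (orderNR r : ℤ)) * (s ^ (4 - n - p : ℤ) * D.weight r) =
      (s ^ p)⁻¹ * (s / D.Λ_R) ^ r 0 * (D.Λ₀ / s) ^ orderNR r := by
  have hs0 := (pos_of_mem hs).ne'
  have hR := D.pos.ne'
  rw [← mul_assoc, ← zpow_add₀ hs0]
  have e : ((n : ℤ) - 4 + (r 0 : ℤ) - (orderNR r : ℤ)) + (4 - n - p : ℤ) =
      (r 0 : ℤ) - (orderNR r : ℤ) - p := by ring
  rw [e, zpow_sub₀ hs0, zpow_sub₀ hs0]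
  unfold weight
  simp only [zpow_natCast, div_pow]
  field_simp

theorem FlowData.norm_irrelevant_le (D : FlowData K N P₀) (r : Fin 5 →₀ ℕ) {n p : ℕ} (hn : 1 ≤ n)
    (hnp : 6 ≤ n + p) (hP₀ : ∀ n p r, NonnegCoeffs (P₀ n p r)) {k : MomConf n}
    (hk : ‖k‖ ≤ 2 * D.Λ₀) : ‖iteratedFDeriv ℝ p (D.L.order r n D.Λ₀) k‖ ≤
      (n * 4) ^ p * (D.Λ₀ ^ (4 - n - p : ℤ) *
        (D.weight r * (P₀ n p r).eval (Real.log (D.Λ₀ / D.Λ_R)))) := by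
  have h0 := D.pos₀
  have hR := D.pos
  have hw := D.weight_pos r
  have hP := (hP₀ n p r).eval_nonneg (log_nonneg D.right_mem)
  refine norm_le_of_relDir ⟨0, hn⟩ _ (by positivity) fun i μ => ?_
  have h := D.irrelevant n p r hn hnp i (fun _ => ⟨0, hn⟩) μ k fun l => by
    have := pow_le_pow_left₀ (norm_nonneg _) ((norm_momentum_le k l).trans hk) 2
    linarith
  have hc : ContDiffAt ℝ (p : ℕ) (D.L.order r n D.Λ₀) k :=
    ((D.contDiff_order hn r D.right_mem).of_le (by exact_mod_cast le_top)).contDiffAt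
  have e : D.L.dimensionless r n D.Λ₀ =
      D.Λ₀ ^ ((n : ℤ) - 4 + (r 0 : ℤ) - (orderNR r : ℤ)) • D.L.order r n D.Λ₀ := rfl
  have hz : 0 < D.Λ₀ ^ ((n : ℤ) - 4 + (r 0 : ℤ) - (orderNR r : ℤ)) := zpow_pos h0 _
  rw [relDeriv, e, iteratedFDeriv_const_smul_apply hc, smul_apply,
    smul_eq_mul, abs_mul, abs_of_pos hz] at h
  refine le_of_mul_le_mul_left (h.trans_eq ?_) hz
  have := D.dimensionless_factor r n p D.right_mem
  rw [div_self h0.ne', one_pow, mul_one] at this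
  rw [← this]
  ring

end BoundaryValues

/-! ### The induction -/

section Boundedness

open FlowData

variable {K : ℝ → ℝ} {N : (Fin 5 →₀ ℕ) → ℕ} {P₀ : ℕ → ℕ → (Fin 5 →₀ ℕ) → Polynomial ℝ}

/-- Data at `Λ_R` are absorbed by the leading term `P = 1`, which is available because they vanish
unless `r_NR = 0`. -/
theorem PowerCounting.of_left (r : Fin 5 →₀ ℕ) {d : ℤ} (hd : 0 ≤ d) :
    PowerCounting r d fun (D : FlowData K N P₀) _ => D.initialBound r d := by
  refine ⟨.C 1, 0, .const zero_le_one, .zero, fun D s hs => ⟨D.initialBound_nonneg r d, ?_⟩⟩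
  have hw := D.weight_pos r
  have h : D.Λ_R ^ d ≤ s ^ d := zpow_le_zpow_left₀ hd D.pos.le hs.1
  unfold initialBound logFactor
  split_ifs
  · simp only [Polynomial.eval_C, Polynomial.eval_zero, mul_zero, add_zero, mul_one]
    gcongr
  · simp

/-- Since `d + 1 ≤ 0`, `Λ₀ ^ d ≤ s ^ d * (s / Λ₀)`: data at `Λ₀` enter only through the suppressed
term. -/
theorem PowerCounting.of_right (r : Fin 5 →₀ ℕ) {d : ℤ} (hd : d ≤ -1) {Q : Polynomial ℝ}
    (hQ : NonnegCoeffs Q) : PowerCounting r d fun (D : FlowData K N P₀) _ =>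
      D.Λ₀ ^ d * (D.weight r * Q.eval (Real.log (D.Λ₀ / D.Λ_R))) := by
  refine ⟨0, Q, .zero, hQ, fun D s hs => ?_⟩
  have hw := D.weight_pos r
  have h0 := D.pos₀
  have hs0 := pos_of_mem hs
  have hq := hQ.eval_nonneg (log_nonneg D.right_mem)
  refine ⟨by positivity, ?_⟩
  have h : D.Λ₀ ^ (d + 1) ≤ s ^ (d + 1) := by
    have := zpow_le_zpow_left₀ (n := -(d + 1)) (by omega) hs0.le hs.2
    rw [zpow_neg, zpow_neg] at this
    exact (inv_le_inv₀ (by positivity) (by positivity)).1 this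
  have hl : D.logFactor r 0 Q s = s / D.Λ₀ * Q.eval (Real.log (D.Λ₀ / D.Λ_R)) := by
    unfold logFactor
    simp
  calc _ = D.Λ₀ ^ (d + 1) / D.Λ₀ * (D.weight r * Q.eval (Real.log (D.Λ₀ / D.Λ_R))) := by
        rw [zpow_add_one₀ h0.ne']
        field_simp
    _ ≤ s ^ (d + 1) / D.Λ₀ * (D.weight r * Q.eval (Real.log (D.Λ₀ / D.Λ_R))) := by gcongr
    _ = _ := by
        rw [hl, zpow_add_one₀ hs0.ne']
        ring

theorem PowerCounting.nonneg {r : Fin 5 →₀ ℕ} {d : ℤ} {f : FlowData K N P₀ → ℝ → ℝ}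
    (h : PowerCounting r d f) (D : FlowData K N P₀) {s : ℝ} (hs : s ∈ D.scales) : 0 ≤ f D s := by
  obtain ⟨P, Q, -, -, h⟩ := h
  exact (h D s hs).1

theorem FlowData.hasDerivWithinAt_finDiff (D : FlowData K N P₀) {n : ℕ} (hn : 1 ≤ n)
    (r : Fin 5 →₀ ℕ) (p : ℕ) (v : Fin p → MomConf n) (x : MomConf n) {s : ℝ} (hs : s ∈ D.scales) :
    HasDerivWithinAt (fun t => finDiff p v (D.L.order r n t) x)
      (finDiff p v (fun k => MvPowerSeries.coeff r
        (polchinskiRHS K D.A D.B D.L.symmetrize n k s)) x) D.scales s :=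
  _root_.hasDerivWithinAt_finDiff p v (fun k => D.isFlow.flow n hn k r s hs) x

/-- Irrelevant derivatives are controlled by their values at `Λ₀`. -/
theorem VertexBound.of_right {r : Fin 5 →₀ ℕ} {n p : ℕ} (hn : 1 ≤ n) (hnp : 5 ≤ n + p)
    {g : FlowData K N P₀ → ℝ → ℝ} (hg : PowerCounting r (4 - n - p - 1) g)
    (hflow : ∀ D, ∀ s ∈ D.scales, FinDiffBound p (2 * s) (g D s) fun k : MomConf n =>
      MvPowerSeries.coeff r (polchinskiRHS K D.A D.B D.L.symmetrize n k s))
    {f : FlowData K N P₀ → ℝ → ℝ} (hf : PowerCounting r (4 - n - p) f)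
    (hinit : ∀ D, ∀ s ∈ D.scales, ∀ k : MomConf n, ‖k‖ ≤ 2 * D.Λ₀ →
      ‖iteratedFDeriv ℝ p (D.L.order r n D.Λ₀) k‖ ≤ f D s) :
    VertexBound K N P₀ r n p := by
  obtain ⟨J, hJ, hJ'⟩ := hg.integrate_down (by omega)
  refine ⟨fun D s => f D s + J D s, hf.add hJ, fun D s hs k hk => ?_⟩
  have hs0 := pos_of_mem hs
  refine FinDiffBound.norm_iteratedFDeriv_le (D.contDiff_order hn r hs) (fun v x hx => ?_)
    (add_nonneg (hf.nonneg D hs) (hJ.nonneg D hs)) (by positivity : 0 < 2 * s) hk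
  -- Integrating down, the ball of radius `2 * s` lies in the admissible ball at every scale `t ≥
  -- s`, so the flow bound holds for all momenta needed.
  have h1 := hJ' D s hs (fun t => finDiff p v (D.L.order r n t) x) _ (∏ a, ‖v a‖)
    (by positivity) (fun t ht => D.hasDerivWithinAt_finDiff hn r p v x ht) fun t ht => by
      rw [mul_comm]
      exact hflow D t ⟨hs.1.trans ht.1, ht.2⟩ v x (hx.trans (by linarith [ht.1]))
  have h2 := FinDiffBound.of_norm_iteratedFDeriv_le (D.contDiff_order hn r D.right_mem)
    (hinit D s hs) v x (hx.trans (by linarith [hs.2]))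
  have h3 := abs_sub_abs_le_abs_sub (finDiff p v (D.L.order r n s) x)
    (finDiff p v (D.L.order r n D.Λ₀) x)
  rw [abs_sub_comm] at h3
  linarith

/-- Relevant derivatives are controlled by their values at zero momentum and `Λ_R`, and by the
derivatives of the next order. -/
theorem VertexBound.of_left {r : Fin 5 →₀ ℕ} {n p : ℕ} (hn : 1 ≤ n) (hnp : n + p ≤ 4)
    {g : FlowData K N P₀ → ℝ → ℝ} (hg : PowerCounting r (4 - n - p - 1) g)
    (hflow : ∀ D, ∀ s ∈ D.scales, FinDiffBound p (2 * s) (g D s) fun k : MomConf n =>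
      MvPowerSeries.coeff r (polchinskiRHS K D.A D.B D.L.symmetrize n k s))
    (h : VertexBound K N P₀ r n (p + 1)) : VertexBound K N P₀ r n p := by
  obtain ⟨J, hJ, hJ'⟩ := hg.integrate_up (by omega)
  obtain ⟨f, hf, hb⟩ := h
  have hf' : PowerCounting (K := K) (N := N) (P₀ := P₀) r (4 - n - p)
      fun D s => 2 * s ^ (1 : ℤ) * f D s := by
    convert hf.const_mul_zpow zero_le_two 1 using 1
    push_cast
    ring
  refine ⟨fun D s => D.initialBound r (4 - n - p) + J D s + 2 * s ^ (1 : ℤ) * f D s,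
    ((PowerCounting.of_left r (by omega)).add hJ).add hf', fun D s hs k hk => ?_⟩
  have hs0 := pos_of_mem hs
  have hR := D.pos
  have c1 := D.contDiff_order hn r hs
  have c2 := D.contDiff_order hn r D.left_mem
  have c3 : ContDiff ℝ ∞ fun k => D.L.order r n s k - D.L.order r n D.Λ_R k := c1.sub c2
  -- Integrating up from `Λ_R`, only the smallest ball is admissible at all scales. This suffices,
  -- since the estimate is used only at zero momentum.
  have h1 : FinDiffBound p (2 * D.Λ_R) (J D s)
      fun k => D.L.order r n s k - D.L.order r n D.Λ_R k := by
    intro v x hx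
    rw [finDiff_sub, mul_comm]
    refine hJ' D s hs (fun t => finDiff p v (D.L.order r n t) x) _ (∏ a, ‖v a‖)
      (by positivity) (fun t ht => D.hasDerivWithinAt_finDiff hn r p v x ht) fun t ht => ?_
    rw [mul_comm]
    exact hflow D t ⟨ht.1, ht.2.trans hs.2⟩ v x (hx.trans (by linarith [ht.1]))
  have h2 := h1.norm_iteratedFDeriv_le c3 (hJ.nonneg D hs) (by positivity) (x := 0)
    (by rw [norm_zero]; positivity)
  have e : iteratedFDeriv ℝ p (fun k => D.L.order r n s k - D.L.order r n D.Λ_R k) 0 =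
      iteratedFDeriv ℝ p (D.L.order r n s) 0 - iteratedFDeriv ℝ p (D.L.order r n D.Λ_R) 0 :=
    iteratedFDeriv_sub_apply (c1.of_le (by exact_mod_cast le_top)).contDiffAt
      (c2.of_le (by exact_mod_cast le_top)).contDiffAt
  rw [e] at h2
  have h3 := norm_sub_norm_le (iteratedFDeriv ℝ p (D.L.order r n s) 0)
    (iteratedFDeriv ℝ p (D.L.order r n D.Λ_R) 0)
  have h4 := D.norm_relevant_le r hn hnp
  have h5 := norm_iteratedFDeriv_le_add_mul c1 (hb D s hs) (hf.nonneg D hs) hk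
  simp only [zpow_one]
  linarith

theorem VertexBound.of_flow {r : Fin 5 →₀ ℕ} {n : ℕ} (hP₀ : ∀ n p r, NonnegCoeffs (P₀ n p r))
    (hn : 1 ≤ n) (h : ∀ p : ℕ, ∃ g : FlowData K N P₀ → ℝ → ℝ, PowerCounting r (4 - n - p - 1) g ∧
      ∀ D, ∀ s ∈ D.scales, FinDiffBound p (2 * s) (g D s) fun k : MomConf n =>
        MvPowerSeries.coeff r (polchinskiRHS K D.A D.B D.L.symmetrize n k s)) (p : ℕ) :
    VertexBound K N P₀ r n p := by
  have hQ : ∀ p, NonnegCoeffs (.C (((n : ℝ) * 4) ^ p) * P₀ n p r) := fun p =>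
    (NonnegCoeffs.const (by positivity)).mul (hP₀ n p r)
  have hirr : ∀ p, 6 ≤ n + p → VertexBound K N P₀ r n p := by
    intro p hp
    obtain ⟨g, hg, hg'⟩ := h p
    refine VertexBound.of_right hn (by omega) hg hg'
      (PowerCounting.of_right r (by omega) (hQ p)) fun D s hs k hk => ?_
    refine (D.norm_irrelevant_le r hn hp hP₀ hk).trans_eq ?_
    rw [Polynomial.eval_mul, Polynomial.eval_C]
    ring
  -- The bare conditions fix only zero momentum; the Taylor remainder over radius `2 * Λ₀` uses the
  -- assumed bound for `p + 1`, hence the factor `2` with `hQ (p + 1)`.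
  have hmarg : ∀ p, n + p = 5 → VertexBound K N P₀ r n p := by
    intro p hp
    obtain ⟨g, hg, hg'⟩ := h p
    refine VertexBound.of_right hn (by omega) hg hg'
      (PowerCounting.of_right r (by omega) ((NonnegCoeffs.const (c := 144) (by norm_num)).add
        ((NonnegCoeffs.const zero_le_two).mul (hQ (p + 1))))) fun D s hs k hk => ?_
    have h0 := D.pos₀
    have hw := D.weight_pos r
    have hq := (hP₀ n (p + 1) r).eval_nonneg (log_nonneg D.right_mem)
    refine (norm_iteratedFDeriv_le_add_mul (D.contDiff_order hn r D.right_mem)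
      (fun k hk => D.norm_irrelevant_le r hn (by omega) hP₀ hk) (by positivity) hk).trans ?_
    refine (add_le_add_left (D.norm_marginal_le r hn hp) _).trans_eq ?_
    have e1 : (4 - n - p : ℤ) = -1 := by omega
    have e2 : (4 - n - (p + 1 : ℕ) : ℤ) = -2 := by omega
    rw [e1, e2]
    have e3 : D.Λ₀ ^ (-2 : ℤ) * D.Λ₀ = D.Λ₀ ^ (-1 : ℤ) := by
      rw [← zpow_add_one₀ h0.ne']
      norm_num
    rw [← e3]
    simp only [Polynomial.eval_add, Polynomial.eval_mul, Polynomial.eval_C]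
    ring
  have hrel : ∀ m p, n + p + m = 5 → VertexBound K N P₀ r n p := by
    intro m
    induction m with
    | zero => exact fun p hp => hmarg p hp
    | succ m ih =>
      intro p hp
      obtain ⟨g, hg, hg'⟩ := h p
      exact VertexBound.of_left hn (by omega) hg hg' (ih (p + 1) (by omega))
  rcases Nat.lt_or_ge (n + p) 6 with hp | hp
  · exact hrel (5 - (n + p)) p (by omega)
  · exact hirr p hp

theorem vertexBound (hK : IsCutoff K) (hP₀ : ∀ n p r, NonnegCoeffs (P₀ n p r))
    (r : Fin 5 →₀ ℕ) (n : ℕ) (hn : 1 ≤ n) (p : ℕ) : VertexBound K N P₀ r n p := by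
  induction hM : ∑ i, r i using Nat.strong_induction_on generalizing r n p with
  | _ M ihM =>
    subst hM
    have hr : ∀ r' : Fin 5 →₀ ℕ, ∑ i, r' i < ∑ i, r i → ∀ m, 1 ≤ m → ∀ p,
        VertexBound K N P₀ r' m p := fun r' h m hm p => ihM _ h r' m hm p rfl
    -- Downward induction in the number of legs: `m` bounds the distance from `n` to the range `n >
    -- N r`, where the vertex functions vanish.
    have key : ∀ m n, 1 ≤ n → N r < n + m → ∀ p, VertexBound K N P₀ r n p := by
      intro m
      induction m with
      | zero =>
        intro n hn hN p
        refine ⟨fun _ _ => 0, PowerCounting.zero _ _, fun D s hs k _ => ?_⟩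
        have : D.L.order r n s = fun _ => 0 :=
          funext fun k => D.isFlow.finite r n hn hN k s hs
        rw [this, iteratedFDeriv_fun_zero]
        simp
      | succ m ih =>
        intro n hn hN p
        exact VertexBound.of_flow hP₀ hn
          (fun p => flow_bound hK hr p (ih (n + 2) (by omega) (by omega) p)) p
    exact key (N r + 1) n hn (by omega) p

end Boundedness

end
theorem mainTheorem7
    (K : ℝ → ℝ) (hK : IsCutoff K) (N : (Fin 5 →₀ ℕ) → ℕ)
    (P₀ : ℕ → ℕ → (Fin 5 →₀ ℕ) → Polynomial ℝ) (hP₀ : ∀ n p r, NonnegCoeffs (P₀ n p r)) :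
    ∃ P Q : ℕ → ℕ → (Fin 5 →₀ ℕ) → Polynomial ℝ,
      (∀ n p r, NonnegCoeffs (P n p r)) ∧ (∀ n p r, NonnegCoeffs (Q n p r)) ∧
      ∀ (A B Λ_R Λ₀ : ℝ), 0 < Λ_R → Λ_R ≤ Λ₀ → |B| ≤ Λ_R ^ 2 → |A| ≤ Λ_R ^ 3 →
      ∀ L : VertexFamily, IsPerturbativeFlow K A B Λ_R Λ₀ N L →
        RenormalizationConditions L Λ_R → BareConditions L Λ₀ →
        (∀ (n p : ℕ) (r : Fin 5 →₀ ℕ), 1 ≤ n → 6 ≤ n + p →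
          RelDerivNormLE Λ₀ p (L.dimensionless r n Λ₀)
            ((Λ₀ ^ p)⁻¹ * (Λ₀ / Λ_R) ^ (r 0) * (P₀ n p r).eval (Real.log (Λ₀ / Λ_R)))) →
        ∀ (n p : ℕ) (r : Fin 5 →₀ ℕ), 1 ≤ n → ∀ Λ ∈ Set.Icc Λ_R Λ₀,
          RelDerivNormLE Λ p (L.dimensionless r n Λ)
            ((Λ ^ p)⁻¹ * (Λ / Λ_R) ^ (r 0) * (Λ₀ / Λ) ^ (orderNR r) *
              ((if orderNR r = 0 then (P n p r).eval (Real.log (Λ / Λ_R)) else 0) +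
                Λ / Λ₀ * (Q n p r).eval (Real.log (Λ₀ / Λ_R)))) := by
  -- The polynomials are fixed before the flow `D` is given, which is the asserted uniformity. The
  -- factor `2 ^ p` accounts for the directions of differentiation, each of norm at most `2`.
  have h : ∀ (n p : ℕ) (r : Fin 5 →₀ ℕ), ∃ P Q : Polynomial ℝ, NonnegCoeffs P ∧ NonnegCoeffs Q ∧
      (1 ≤ n → ∀ (D : FlowData K N P₀), ∀ s ∈ D.scales, ∀ k : MomConf n, ‖k‖ ≤ 2 * s →
        2 ^ p * ‖iteratedFDeriv ℝ p (D.L.order r n s) k‖ ≤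
          s ^ (4 - n - p : ℤ) * (D.weight r * D.logFactor r P Q s)) := by
    intro n p r
    by_cases hn : 1 ≤ n
    · obtain ⟨f, hf, hb⟩ := vertexBound (N := N) hK hP₀ r n hn p
      obtain ⟨P, Q, hP, hQ, hPQ⟩ := hf.const_mul (c := 2 ^ p) (by positivity)
      refine ⟨P, Q, hP, hQ, fun _ D s hs k hk => le_trans ?_ (hPQ D s hs).2⟩
      exact mul_le_mul_of_nonneg_left (hb D s hs k hk) (by positivity)
    · exact ⟨0, 0, .zero, .zero, fun h => absurd h hn⟩
  choose P Q hP hQ hPQ using h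
  refine ⟨P, Q, hP, hQ, fun A B Λ_R Λ₀ hR hle hB _ L hL hren hbare hirr n p r hn Λ hΛ i j μ k hk => ?_⟩
  let D : FlowData K N P₀ := ⟨A, B, Λ_R, Λ₀, L, hR, hle, hB, hL, hren, hbare, hirr⟩
  have hs : Λ ∈ D.scales := hΛ
  have hΛ0 : 0 < Λ := FlowData.pos_of_mem hs
  have hk' : ‖k‖ ≤ 2 * Λ := (MomConf.norm_le_iff (by positivity)).2 fun l => by
    refine abs_le_of_sq_le_sq' ?_ (by positivity) |>.2
    linarith [hk l]
  have hc : ContDiffAt ℝ (p : ℕ) (L.order r n Λ) k :=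
    ((D.contDiff_order hn r hs).of_le (by exact_mod_cast le_top)).contDiffAt
  have e : L.dimensionless r n Λ =
      Λ ^ ((n : ℤ) - 4 + (r 0 : ℤ) - (orderNR r : ℤ)) • L.order r n Λ := rfl
  have hz : 0 < Λ ^ ((n : ℤ) - 4 + (r 0 : ℤ) - (orderNR r : ℤ)) := zpow_pos hΛ0 _
  have h1 : |iteratedFDeriv ℝ p (L.order r n Λ) k fun a => relDir (i a) (j a) (μ a)| ≤
      2 ^ p * ‖iteratedFDeriv ℝ p (L.order r n Λ) k‖ := by
    refine ((iteratedFDeriv ℝ p (L.order r n Λ) k).le_opNorm _).trans ?_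
    rw [mul_comm]
    refine mul_le_mul_of_nonneg_right ?_ (norm_nonneg _)
    refine (Finset.prod_le_prod (fun _ _ => norm_nonneg _)
      fun a _ => norm_relDir_le (i a) (j a) (μ a)).trans_eq ?_
    simp
  rw [relDeriv, e, iteratedFDeriv_const_smul_apply hc, smul_apply,
    smul_eq_mul, abs_mul, abs_of_pos hz]
  have h2 := D.dimensionless_factor r n p hs
  calc _ ≤ Λ ^ ((n : ℤ) - 4 + (r 0 : ℤ) - (orderNR r : ℤ)) *
        (Λ ^ (4 - n - p : ℤ) * (D.weight r * D.logFactor r (P n p r) (Q n p r) Λ)) := by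
        exact mul_le_mul_of_nonneg_left (h1.trans (hPQ n p r hn D Λ hs k hk')) hz.le
    _ = (Λ ^ ((n : ℤ) - 4 + (r 0 : ℤ) - (orderNR r : ℤ)) *
        (Λ ^ (4 - n - p : ℤ) * D.weight r)) * D.logFactor r (P n p r) (Q n p r) Λ := by ring
    _ = _ := by
        rw [h2]
        rfl
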